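/- **Language.** Let $\mathcal L$ be a countable first-order language (individual constants, function symbols, predicate symbols) with a distinguished unary predicate $E$. Formulas are built from $\top$, $\bot$ and the atomic formulas by $\land,\lor,\to,\neg,\forall x,\exists x$, with $\neg$ primitive; ${\rightharpoondown}A$ abbreviates $A\to\bot$. The class $\mathrm{GN}$ consists of $\bot$, all $\neg A$, and is closed under $\land,\lor,\to$, under $N\mapsto\forall xN$, and under $N\mapsto\exists xN$ when $x$ occurs free in $N$. A variable $x$ *occurs only globally in* $A$ if it occurs free in $A$ and each of its free occurrences lies in a $\mathrm{GN}$ subformula of $A$; then $\forall xA$, $\exists xA$ are *global*, and otherwise (in particular if $x$ does not occur free) *local*. The class $\mathrm{ST}$ is given by $S::=\top\mid N\mid S\land S\mid S\lor N\mid N\lor S\mid A\to B\mid\forall xA$ with $N\in\mathrm{GN}$ and $A,B$ arbitrary; $\mathrm{ST_P}$ is given by $S'::=S\mid S'\lor S'\mid\exists xS'$ with $S\in\mathrm{ST}$ and $\exists xS'$ global. **The system $\mathrm{NSF_P}$** is the natural deduction system with the usual introduction and elimination rules for $\land$ and $\lor$, and: $\top$; from $\bot$ infer $A$; from $P(t_1,\dots,t_n)$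 infer $E(t_i)$; from $E(f(t_1,\dots,t_n))$ infer $E(t_i)$; from ${\rightharpoondown}{\rightharpoondown}S$ infer $S$ for $S\in\mathrm{ST_P}$; from a derivation of ${\rightharpoondown}{\rightharpoondown}B$ from $A$ infer $A\to B$, discharging $A$; from $A\to B$ and $A$ infer ${\rightharpoondown}{\rightharpoondown}B$; from ${\rightharpoondown}A$ infer $\neg A$; from $\neg A$ and $A$ infer $\bot$; the axioms $\neg\neg A\to A$ and $\forall x\,\neg\neg E(x)$; from ${\rightharpoondown}{\rightharpoondown}A$ infer $\forall xA$, if $x$ is not free in the open hypotheses; from $\forall xA$ infer ${\rightharpoondown}{\rightharpoondown}A[t/x]$; from $A[t/x]$ (and also $E(t)$, if $\exists xA$ is local) infer $\exists xA$; from $\exists yA$ and a derivation of $C$ from $A[x/y]$ (and also $E(x)$, if $\exists yA$ is local) infer $C$, discharging these hypotheses, if $x$ is not free in $\exists yA$, in $C$ or in the other open hypotheses. Substituted terms are required to be free for the variable. $\vdash A$ means that $A$ is derivable without hypotheses. $\mathbf{SFQ_P}$ is the set of the closed formulas $A$ with $\vdash A$, and $\mathbf{SFQ}_{\mathbf P}^{-\rightharpoondown}$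 the set of those in which the combination $\to\bot$ does not occur. **Models.** A strict finitistic model $W=\langle K,\le,D,J,v\rangle$ consists of a rooted tree-like partial order $K$ with at most countable branching and height at most $\omega$, a nonempty domain $D$, an interpretation $J$ of the constants and function symbols in $D$ (the name of $d\in D$ in the language $\mathcal L(D)$ being interpreted by $d$), and extensions $P^{v(k)}\subseteq D^n$, increasing in $k$, such that $\langle J(c_1),\dots,J(c_n)\rangle\in P^{v(k)}$ implies $J(c')\in E^{v(k)}$ for all subterms $c'$ of each $c_i$ ($c_1,\dots,c_n$ closed terms of $\mathcal L(D)$), and such that $\{P\mid P^{v(k)}\ne\emptyset\}$ is finite for each $k$. For closed formulas of $\mathcal L(D)$: $\top,\bot$, atoms, $\land,\lor$ are evaluated as usual at each node; $k\models A\to B$ iff for every $k'\ge k$ with $k'\models A$ there is $k''\ge k'$ with $k''\models B$; $k\models\neg A$ iff $l\not\models A$ for all $l\in K$; $k\models\forall xA$ iff for all $d\in D$, $k\models\top\to A[d/x]$ (global case), respectively $k\models E(d)\to A[d/x]$ (local case); $k\models\exists xA$ iff for some $d\in D$, $k\models A[d/x]$ (global case), respectively $k\models E(d)\land A[d/x]$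 (local case). An open formula is forced iff its universal closure is. $W$ is *prevalent* if every closed $A$ of $\mathcal L(D)$ that is forced at some node, and every $E(d)$ with $d\in D$, is forced at some node above each node of $K$. Let $\mathcal W_{\mathrm P2\emptyset}$ be the class of the prevalent models with exactly two nodes in which no $E(c)$ is forced at the root. **Occurrences.** A formula context $F$ is a formula with one placeholder; $F[B]$ is the result of putting $B$ in its place (variables of $B$ may become bound). For a node $k$ of a model, $\mathcal M_k$ is the smallest set of pairs $\langle F,B\rangle$ over $\mathcal L(D)$ such that * $\langle *,B\rangle$, $\langle F\to A,B\rangle$, $\langle A\to F,B\rangle$, $\langle\neg F,B\rangle$, $\langle\forall xF,B\rangle\in\mathcal M_k$; * $\langle F\land A,B\rangle,\langle A\land F,B\rangle\in\mathcal M_k$ if $\langle F,B\rangle\in\mathcal M_k$; * $\langle F\lor A,B\rangle,\langle A\lor F,B\rangle\in\mathcal M_k$ if $\langle F,B\rangle\in\mathcal M_k$ or $k\models A$; * $\langle\exists xF,B\rangle\in\mathcal M_k$ if (1) $\exists x(F[\neg B])$ is local or $\exists x(F[{\rightharpoondown}B])$ is global, and (2) either, for all $d\in D$, $k\models(F[\neg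 B])[d/x]$ implies $\langle F[d/x],B[d/x]\rangle\in\mathcal M_k$, or $k\models\exists x(F[{\rightharpoondown}B])$. Here $B[d/x]$ is to be read as $B$ if $F$ itself binds $x$ above the placeholder, so that $(F[B])[d/x]$ is always the formula of the pair $\langle F[d/x],B[d/x]\rangle$. Let $\mathcal M$ be the set of the pairs $\langle F,B\rangle$ over $\mathcal L$ that lie in $\mathcal M_r$ for the root $r$ of every $W\in\mathcal W_{\mathrm P2\emptyset}$. Put $\Phi(A)=\{F[{\rightharpoondown}B]\mid\langle F,B\rangle\in\mathcal M,\ A=F[\neg B]\}$ and $\Phi[X]=\bigcup_{A\in X}\Phi(A)$. **Proposition.** (i) If $F[{\rightharpoondown}B]$ is closed and $\vdash F[{\rightharpoondown}B]$, then $\langle F,B\rangle\in\mathcal M$. (ii) $\mathbf{SFQ_P}=\bigcup_{n=0}^{\infty}\Phi^n\bigl[\mathbf{SFQ}_{\mathbf P}^{-\rightharpoondown}\bigr]$. -/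

import Mathlib

open scoped FirstOrder

namespace SFQ

open FirstOrder.Language

/-! ## Language and formulas -/

/-- A first-order language with a distinguished unary predicate `E` (the existence predicate).
Individual constants are the function symbols of arity `0`. -/
class HasE (L : FirstOrder.Language.{0, 0}) where
  /-- the existence predicate -/
  E : L.Relations 1

/-- Formulas, with variables `v_0, v_1, ...` (indexed by `ℕ`) and named bound variables.
The symbol `¬` is primitive. -/
inductive Fm (L : FirstOrder.Language.{0, 0}) : Type
  | top : Fm L
  | bot : Fm L
  | rel {n : ℕ} (P : L.Relations n) (ts : Fin n → L.Term ℕ) : Fm L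
  | and (A B : Fm L) : Fm L
  | or (A B : Fm L) : Fm L
  | imp (A B : Fm L) : Fm L
  | neg (A : Fm L) : Fm L
  | all (x : ℕ) (A : Fm L) : Fm L
  | ex (x : ℕ) (A : Fm L) : Fm L

namespace Fm

variable {L : FirstOrder.Language.{0, 0}}

/-- `⇁A`, the abbreviation of `A → ⊥`. -/
def wneg (A : Fm L) : Fm L := imp A bot

/-- The atomic formula `E(t)`. -/
def exi [HasE L] (t : L.Term ℕ) : Fm L := rel HasE.E (fun _ : Fin 1 => t)

/-- The set of the free variables. -/
def fv : Fm L → Finset ℕ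
  | top => ∅
  | bot => ∅
  | rel _ ts => Finset.univ.biUnion fun i => (ts i).varFinset
  | and A B => A.fv ∪ B.fv
  | or A B => A.fv ∪ B.fv
  | imp A B => A.fv ∪ B.fv
  | neg A => A.fv
  | all x A => A.fv.erase x
  | ex x A => A.fv.erase x

/-- Closed formulas. -/
def Closed (A : Fm L) : Prop := A.fv = ∅

/-- The universal closure, bounding the free variables in the order of their indices. -/
def uclosure (A : Fm L) : Fm L := (A.fv.sort (· ≤ ·)).foldr all A

end Fm

/-- Substitution `s[t/x]` in a term. -/
def tsubst {L : FirstOrder.Language.{0, 0}} (x : ℕ) (t : L.Term ℕ) (s : L.Term ℕ) : L.Term ℕ :=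
  s.subst fun y => if y = x then t else Term.var y

/-- Closed terms. -/
def TClosed {L : FirstOrder.Language.{0, 0}} (t : L.Term ℕ) : Prop := t.varFinset = ∅

/-- `Subterm s t`: `s` is a subterm of `t` (possibly `t` itself). -/
inductive Subterm {L : FirstOrder.Language.{0, 0}} : L.Term ℕ → L.Term ℕ → Prop
  | refl (t : L.Term ℕ) : Subterm t t
  | func {n : ℕ} (f : L.Functions n) (ts : Fin n → L.Term ℕ) (i : Fin n) (s : L.Term ℕ) :
      Subterm s (ts i) → Subterm s (Term.func f ts)

namespace Fm

variable {L : FirstOrder.Language.{0, 0}}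

/-- `A.subst x t` is `A[t/x]`: replace the free occurrences of `x` by `t`. -/
def subst (x : ℕ) (t : L.Term ℕ) : Fm L → Fm L
  | top => top
  | bot => bot
  | rel P ts => rel P fun i => tsubst x t (ts i)
  | and A B => and (A.subst x t) (B.subst x t)
  | or A B => or (A.subst x t) (B.subst x t)
  | imp A B => imp (A.subst x t) (B.subst x t)
  | neg A => neg (A.subst x t)
  | all y A => if y = x then all y A else all y (A.subst x t)
  | ex y A => if y = x then ex y A else ex y (A.subst x t)

/-- `t` is free for `x` in the formula. -/
def FreeFor (x : ℕ) (t : L.Term ℕ) : Fm L → Prop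
  | top => True
  | bot => True
  | rel _ _ => True
  | and A B => A.FreeFor x t ∧ B.FreeFor x t
  | or A B => A.FreeFor x t ∧ B.FreeFor x t
  | imp A B => A.FreeFor x t ∧ B.FreeFor x t
  | neg A => A.FreeFor x t
  | all y A => x ∉ (all y A).fv ∨ (y ∉ t.varFinset ∧ A.FreeFor x t)
  | ex y A => x ∉ (ex y A).fv ∨ (y ∉ t.varFinset ∧ A.FreeFor x t)

/-- The class `GN` of the global negative formulas. In `∃x N` the quantified variable is required to
occur: a vacuous `∃x N` is a local quantification, which is not global negative. -/
inductive GN : Fm L → Prop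
  | bot : GN bot
  | neg (A : Fm L) : GN (neg A)
  | and {M N : Fm L} : GN M → GN N → GN (and M N)
  | or {M N : Fm L} : GN M → GN N → GN (or M N)
  | imp {M N : Fm L} : GN M → GN N → GN (imp M N)
  | all (x : ℕ) {N : Fm L} : GN N → GN (all x N)
  | ex (x : ℕ) {N : Fm L} : x ∈ N.fv → GN N → GN (ex x N)

/-- `x` has a non-global free occurrence in the formula, i.e. a free occurrence that lies in no
`GN` subformula. -/
def LocOcc (x : ℕ) : Fm L → Prop
  | top => False
  | bot => False
  | rel P ts => x ∈ (rel P ts).fv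
  | and A B => ¬ GN (and A B) ∧ (A.LocOcc x ∨ B.LocOcc x)
  | or A B => ¬ GN (or A B) ∧ (A.LocOcc x ∨ B.LocOcc x)
  | imp A B => ¬ GN (imp A B) ∧ (A.LocOcc x ∨ B.LocOcc x)
  | neg _ => False
  | all y A => ¬ GN (all y A) ∧ y ≠ x ∧ A.LocOcc x
  | ex y A => ¬ GN (ex y A) ∧ y ≠ x ∧ A.LocOcc x

/-- `x` occurs (free) in `A`, and only globally. Then `∀x A` and `∃x A` are global quantifications;
otherwise, including the case that `x` does not occur, they are local. -/
def OnlyGlobal (x : ℕ) (A : Fm L) : Prop := x ∈ A.fv ∧ ¬ A.LocOcc x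

/-- The class `ST`. -/
inductive ST : Fm L → Prop
  | top : ST top
  | gn {N : Fm L} : GN N → ST N
  | and {S T : Fm L} : ST S → ST T → ST (and S T)
  | or_gn {S N : Fm L} : ST S → GN N → ST (or S N)
  | gn_or {N S : Fm L} : GN N → ST S → ST (or N S)
  | imp (A B : Fm L) : ST (imp A B)
  | all (x : ℕ) (A : Fm L) : ST (all x A)

/-- The class `ST_P`. -/
inductive STP : Fm L → Prop
  | st {S : Fm L} : ST S → STP S
  | or {S T : Fm L} : STP S → STP T → STP (or S T)
  | ex (x : ℕ) {S : Fm L} : OnlyGlobal x S → STP S → STP (ex x S)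

/-- The combination `→ ⊥` does not occur in the formula. -/
def WnegFree : Fm L → Prop
  | top => True
  | bot => True
  | rel _ _ => True
  | and A B => A.WnegFree ∧ B.WnegFree
  | or A B => A.WnegFree ∧ B.WnegFree
  | imp A B => B ≠ bot ∧ A.WnegFree ∧ B.WnegFree
  | neg A => A.WnegFree
  | all _ A => A.WnegFree
  | ex _ A => A.WnegFree

/-- Translation of formulas along a map of languages. -/
def map {L' : FirstOrder.Language.{0, 0}} (φ : L →ᴸ L') : Fm L → Fm L'
  | top => top
  | bot => bot
  | rel P ts => rel (φ.onRelation P) fun i => φ.onTerm (ts i)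
  | and A B => and (A.map φ) (B.map φ)
  | or A B => or (A.map φ) (B.map φ)
  | imp A B => imp (A.map φ) (B.map φ)
  | neg A => neg (A.map φ)
  | all x A => all x (A.map φ)
  | ex x A => ex x (A.map φ)

end Fm

/-! ## The natural deduction system NSF_P -/

open Fm in
/-- `NSFp Γ A`: there is a derivation of `A` in `NSF_P` whose open hypotheses all belong to `Γ`.
The rule `weaken` makes `Γ` an upper bound of the set of the open hypotheses, so that the
conditions on the eigenvariables concern the hypotheses that are actually used. -/
inductive NSFp {L : FirstOrder.Language.{0, 0}} [HasE L] : Set (Fm L) → Fm L → Prop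
  | hyp {Γ : Set (Fm L)} {A : Fm L} : A ∈ Γ → NSFp Γ A
  | weaken {Γ Δ : Set (Fm L)} {A : Fm L} : Γ ⊆ Δ → NSFp Γ A → NSFp Δ A
  | andI {Γ : Set (Fm L)} {A B : Fm L} : NSFp Γ A → NSFp Γ B → NSFp Γ (and A B)
  | andE₁ {Γ : Set (Fm L)} {A B : Fm L} : NSFp Γ (and A B) → NSFp Γ A
  | andE₂ {Γ : Set (Fm L)} {A B : Fm L} : NSFp Γ (and A B) → NSFp Γ B
  | orI₁ {Γ : Set (Fm L)} {A B : Fm L} : NSFp Γ A → NSFp Γ (or A B)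
  | orI₂ {Γ : Set (Fm L)} {A B : Fm L} : NSFp Γ B → NSFp Γ (or A B)
  | orE {Γ : Set (Fm L)} {A B C : Fm L} : NSFp Γ (or A B) → NSFp (insert A Γ) C →
      NSFp (insert B Γ) C → NSFp Γ C
  | topI {Γ : Set (Fm L)} : NSFp Γ top
  | botE {Γ : Set (Fm L)} {A : Fm L} : NSFp Γ bot → NSFp Γ A
  | str₁ {Γ : Set (Fm L)} {n : ℕ} {P : L.Relations n} {ts : Fin n → L.Term ℕ} (i : Fin n) :
      NSFp Γ (rel P ts) → NSFp Γ (exi (ts i))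
  | str₂ {Γ : Set (Fm L)} {n : ℕ} {f : L.Functions n} {ts : Fin n → L.Term ℕ} (i : Fin n) :
      NSFp Γ (exi (Term.func f ts)) → NSFp Γ (exi (ts i))
  | stp {Γ : Set (Fm L)} {S : Fm L} : STP S → NSFp Γ (wneg (wneg S)) → NSFp Γ S
  | impI {Γ : Set (Fm L)} {A B : Fm L} : NSFp (insert A Γ) (wneg (wneg B)) → NSFp Γ (imp A B)
  | impE {Γ : Set (Fm L)} {A B : Fm L} : NSFp Γ (imp A B) → NSFp Γ A → NSFp Γ (wneg (wneg B))
  | negI {Γ : Set (Fm L)} {A : Fm L} : NSFp Γ (wneg A) → NSFp Γ (neg A)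
  | negE {Γ : Set (Fm L)} {A : Fm L} : NSFp Γ (neg A) → NSFp Γ A → NSFp Γ bot
  | dne {Γ : Set (Fm L)} (A : Fm L) : NSFp Γ (imp (neg (neg A)) A)
  | obj {Γ : Set (Fm L)} (x : ℕ) : NSFp Γ (all x (neg (neg (exi (Term.var x)))))
  | allI {Γ : Set (Fm L)} {x : ℕ} {A : Fm L} : (∀ B ∈ Γ, x ∉ B.fv) →
      NSFp Γ (wneg (wneg A)) → NSFp Γ (all x A)
  | allE {Γ : Set (Fm L)} {x : ℕ} {A : Fm L} (t : L.Term ℕ) : A.FreeFor x t →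
      NSFp Γ (all x A) → NSFp Γ (wneg (wneg (A.subst x t)))
  | exGloI {Γ : Set (Fm L)} {x : ℕ} {A : Fm L} (t : L.Term ℕ) : A.FreeFor x t →
      OnlyGlobal x A → NSFp Γ (A.subst x t) → NSFp Γ (ex x A)
  | exLocI {Γ : Set (Fm L)} {x : ℕ} {A : Fm L} (t : L.Term ℕ) : A.FreeFor x t →
      ¬ OnlyGlobal x A → NSFp Γ (A.subst x t) → NSFp Γ (exi t) → NSFp Γ (ex x A)
  | exGloE {Γ : Set (Fm L)} {x y : ℕ} {A C : Fm L} : A.FreeFor y (Term.var x) →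
      OnlyGlobal y A → x ∉ (ex y A).fv → x ∉ C.fv → (∀ B ∈ Γ, x ∉ B.fv) →
      NSFp Γ (ex y A) → NSFp (insert (A.subst y (Term.var x)) Γ) C → NSFp Γ C
  | exLocE {Γ : Set (Fm L)} {x y : ℕ} {A C : Fm L} : A.FreeFor y (Term.var x) →
      ¬ OnlyGlobal y A → x ∉ (ex y A).fv → x ∉ C.fv → (∀ B ∈ Γ, x ∉ B.fv) →
      NSFp Γ (ex y A) →
      NSFp (insert (A.subst y (Term.var x)) (insert (exi (Term.var x)) Γ)) C → NSFp Γ C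

/-! ## Strict finitistic models -/

/-- The language `L(D)`, i.e. `L` with a name for each element of `D` as a new constant, is
Mathlib's `L[[D]]`; its existence predicate is that of `L`. -/
instance instHasEWithConstants (L : FirstOrder.Language.{0, 0}) [HasE L] (D : Type) : HasE (L[[D]]) :=
  ⟨(L.lhomWithConstants D).onRelation HasE.E⟩

/-- The name of `d`, as a term of `L(D)`. -/
def name (L : FirstOrder.Language.{0, 0}) {D : Type} (d : D) : (L[[D]]).Term ℕ := (L.con d).term

/-- Intuitionistic models with a constant domain, on a rooted tree-like frame with at most
countable branching and height at most `ω`. -/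
structure CDModel (L : FirstOrder.Language.{0, 0}) where
  /-- the nodes -/
  K : Type
  [order : PartialOrder K]
  /-- the root -/
  root : K
  root_le : ∀ k, root ≤ k
  chain_below : ∀ k : K, IsChain (· ≤ ·) (Set.Iic k)
  finite_below : ∀ k : K, (Set.Iic k).Finite
  countable_branching : ∀ k : K, {k' : K | k ⋖ k'}.Countable
  /-- the domain -/
  D : Type
  [nonempty : Nonempty D]
  /-- the interpretation of the function symbols and the constants -/
  J : ∀ {n : ℕ}, L.Functions n → (Fin n → D) → D
  /-- the extension of each predicate at each node -/
  v : K → ∀ {n : ℕ}, L.Relations n → Set (Fin n → D)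
  v_mono : ∀ {k k' : K}, k ≤ k' → ∀ {n : ℕ} (P : L.Relations n), v k P ⊆ v k' P

attribute [instance] CDModel.order CDModel.nonempty

namespace CDModel

variable {L : FirstOrder.Language.{0, 0}} (W : CDModel L)

/-- The first-order structure at the node `k`. -/
@[reducible] def str (k : W.K) : L.Structure W.D where
  funMap f xs := W.J f xs
  RelMap P xs := xs ∈ W.v k P

/-- The same structure, for the language `L(D)`; the name of `d` denotes `d`. -/
@[reducible] def strD (k : W.K) : (L[[W.D]]).Structure W.D :=
  letI := W.str k
  L.withConstantsSelfStructure

/-- The denotation of a term of `L(D)` under an assignment of the variables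
(which plays no role for closed terms; nor does the node). -/
def val (s : ℕ → W.D) (t : (L[[W.D]]).Term ℕ) : W.D :=
  letI := W.strD W.root
  t.realize s

end CDModel

/-- Strict finitistic models: the class `𝓦`. -/
structure SFModel (L : FirstOrder.Language.{0, 0}) [HasE L] extends CDModel L where
  strictness : ∀ (k : K) {n : ℕ} (P : L.Relations n) (c : Fin n → (L[[D]]).Term ℕ) (s : ℕ → D),
    (∀ i, TClosed (c i)) → (fun i => toCDModel.val s (c i)) ∈ v k P →
    ∀ (i : Fin n) (c' : (L[[D]]).Term ℕ), Subterm c' (c i) →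
      (fun _ : Fin 1 => toCDModel.val s c') ∈ v k HasE.E
  finite_verification : ∀ k : K, {P : Σ n, L.Relations n | (v k P.2).Nonempty}.Finite

namespace SFModel

variable {L : FirstOrder.Language.{0, 0}} [HasE L] (W : SFModel L)

/-- Actual verification at a node, for formulas of `L(D)` under an assignment `s`. Taking
`d` as the value of `x` stands for the substitution of the name of `d` for `x`. -/
def Sat : W.K → (ℕ → W.D) → Fm (L[[W.D]]) → Prop
  | _, _, .top => True
  | _, _, .bot => False
  | k, s, .rel P ts => (W.strD k).RelMap P fun i => W.val s (ts i)
  | k, s, .and A B => Sat k s A ∧ Sat k s B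
  | k, s, .or A B => Sat k s A ∨ Sat k s B
  | k, s, .imp A B => ∀ k' ≥ k, Sat k' s A → ∃ k'' ≥ k', Sat k'' s B
  | _, s, .neg A => ∀ l : W.K, ¬ Sat l s A
  | k, s, .all x A => ∀ d : W.D, ∀ k' ≥ k,
      (Fm.OnlyGlobal x A ∨ (fun _ : Fin 1 => d) ∈ W.v k' HasE.E) →
        ∃ k'' ≥ k', Sat k'' (Function.update s x d) A
  | k, s, .ex x A => ∃ d : W.D,
      (Fm.OnlyGlobal x A ∨ (fun _ : Fin 1 => d) ∈ W.v k HasE.E) ∧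
        Sat k (Function.update s x d) A

/-- `k ⊨ A`; an open formula is forced when its universal closure is. -/
def Forces (k : W.K) (A : Fm (L[[W.D]])) : Prop := ∀ s : ℕ → W.D, W.Sat k s A.uclosure

/-- `A` is prevalent in `W`. -/
def Prev (A : Fm (L[[W.D]])) : Prop := ∀ k, ∃ k' ≥ k, W.Forces k' A

/-- The prevalent models: every assertible closed formula of `L(D)` is prevalent (formula
prevalence), and so is `E(d)` for every object `d` (object prevalence). -/
def IsPrevalent : Prop :=
  (∀ A : Fm (L[[W.D]]), A.Closed → (∃ k, W.Forces k A) → W.Prev A) ∧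
    ∀ d : W.D, W.Prev (Fm.exi (name L d))

/-- The model has exactly two nodes. -/
def IsTwoNode : Prop := Nat.card W.K = 2

/-- Preconstructive models: no `E(c)` is forced at the root. -/
def IsPreconstructive : Prop :=
  ∀ c : (L[[W.D]]).Term ℕ, TClosed c → ¬ W.Forces W.root (Fm.exi c)

end SFModel

/-! ## Formula contexts -/

/-- Formula contexts, i.e. formulas with one placeholder `*`. -/
inductive Cont (L : FirstOrder.Language.{0, 0}) : Type
  | hole : Cont L
  | andL (F : Cont L) (A : Fm L) : Cont L
  | andR (A : Fm L) (F : Cont L) : Cont L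
  | orL (F : Cont L) (A : Fm L) : Cont L
  | orR (A : Fm L) (F : Cont L) : Cont L
  | impL (F : Cont L) (A : Fm L) : Cont L
  | impR (A : Fm L) (F : Cont L) : Cont L
  | neg (F : Cont L) : Cont L
  | all (x : ℕ) (F : Cont L) : Cont L
  | ex (x : ℕ) (F : Cont L) : Cont L

namespace Cont

variable {L : FirstOrder.Language.{0, 0}}

/-- `F.fill B` is `F[B]`. Variables of `B` may become bound. -/
def fill : Cont L → Fm L → Fm L
  | hole, B => B
  | andL F A, B => .and (F.fill B) A
  | andR A F, B => .and A (F.fill B)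
  | orL F A, B => .or (F.fill B) A
  | orR A F, B => .or A (F.fill B)
  | impL F A, B => .imp (F.fill B) A
  | impR A F, B => .imp A (F.fill B)
  | neg F, B => .neg (F.fill B)
  | all x F, B => .all x (F.fill B)
  | ex x F, B => .ex x (F.fill B)

/-- Substitution `F[t/x]` in a context; the placeholder is left alone. -/
def subst (x : ℕ) (t : L.Term ℕ) : Cont L → Cont L
  | hole => hole
  | andL F A => andL (F.subst x t) (A.subst x t)
  | andR A F => andR (A.subst x t) (F.subst x t)
  | orL F A => orL (F.subst x t) (A.subst x t)
  | orR A F => orR (A.subst x t) (F.subst x t)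
  | impL F A => impL (F.subst x t) (A.subst x t)
  | impR A F => impR (A.subst x t) (F.subst x t)
  | neg F => neg (F.subst x t)
  | all y F => if y = x then all y F else all y (F.subst x t)
  | ex y F => if y = x then ex y F else ex y (F.subst x t)

/-- The set of the variables bound in `F` by a quantifier that has the placeholder in its scope. -/
def binders : Cont L → Finset ℕ
  | hole => ∅
  | andL F _ => F.binders
  | andR _ F => F.binders
  | orL F _ => F.binders
  | orR _ F => F.binders
  | impL F _ => F.binders
  | impR _ F => F.binders
  | neg F => F.binders
  | all x F => insert x F.binders
  | ex x F => insert x F.binders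

/-- The formula that fills the placeholder after the substitution of `t` for `x` in `F[B]`. It is
`B[t/x]`, except when `F` binds `x` again above the placeholder; the exception does not arise if
the bound variables of the formula under consideration are unique. -/
def substFill (F : Cont L) (x : ℕ) (t : L.Term ℕ) (B : Fm L) : Fm L :=
  if x ∈ F.binders then B else B.subst x t

/-- Translation of contexts along a map of languages. -/
def map {L' : FirstOrder.Language.{0, 0}} (φ : L →ᴸ L') : Cont L → Cont L'
  | hole => hole
  | andL F A => andL (F.map φ) (A.map φ)
  | andR A F => andR (A.map φ) (F.map φ)
  | orL F A => orL (F.map φ) (A.map φ)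
  | orR A F => orR (A.map φ) (F.map φ)
  | impL F A => impL (F.map φ) (A.map φ)
  | impR A F => impR (A.map φ) (F.map φ)
  | neg F => neg (F.map φ)
  | all x F => all x (F.map φ)
  | ex x F => ex x (F.map φ)

/-- Substitution in `F[B]` acts on the formula occurrence `⟨F, B⟩`. -/
theorem fill_subst (F : Cont L) (B : Fm L) (x : ℕ) (t : L.Term ℕ) :
    (F.fill B).subst x t = (F.subst x t).fill (F.substFill x t B) := by
  unfold substFill
  induction F with
  | hole => simp [fill, subst, binders]
  | all y F ih | ex y F ih =>
    by_cases h : y = x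
    · simp [fill, subst, binders, Fm.subst, h]
    · have h' : x ≠ y := fun e => h e.symm
      simp only [fill, subst, binders, Fm.subst, if_neg h, Finset.mem_insert, h', false_or, ih]
  | _ => simp only [fill, subst, binders, Fm.subst, *]; rfl

end Cont

/-! ## The class `𝓜`, the operation `Φ` and the sets of theorems -/

/-- The set `𝓜_k` of formula occurrences over `L(D)`, for a node `k` of `W`. -/
inductive MK {L : FirstOrder.Language.{0, 0}} [HasE L] (W : SFModel L) (k : W.K) :
    Cont (L[[W.D]]) → Fm (L[[W.D]]) → Prop
  | hole (B) : MK W k .hole B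
  | impL (F A B) : MK W k (.impL F A) B
  | impR (F A B) : MK W k (.impR A F) B
  | neg (F B) : MK W k (.neg F) B
  | all (x F B) : MK W k (.all x F) B
  | andL (F A B) : MK W k F B → MK W k (.andL F A) B
  | andR (F A B) : MK W k F B → MK W k (.andR A F) B
  | orL (F A B) : MK W k F B → MK W k (.orL F A) B
  | orR (F A B) : MK W k F B → MK W k (.orR A F) B
  | orL_forced (F A B) : W.Forces k A → MK W k (.orL F A) B
  | orR_forced (F A B) : W.Forces k A → MK W k (.orR A F) B
  | ex_inst (x F B) :
      (¬ Fm.OnlyGlobal x (F.fill (.neg B)) ∨ Fm.OnlyGlobal x (F.fill (.wneg B))) →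
      (∀ d : W.D, W.Forces k ((F.fill (.neg B)).subst x (name L d)) →
        MK W k (F.subst x (name L d)) (F.substFill x (name L d) B)) →
      MK W k (.ex x F) B
  | ex_forced (x F B) :
      (¬ Fm.OnlyGlobal x (F.fill (.neg B)) ∨ Fm.OnlyGlobal x (F.fill (.wneg B))) →
      W.Forces k (.ex x (F.fill (.wneg B))) →
      MK W k (.ex x F) B

variable (L : FirstOrder.Language.{0, 0}) [HasE L]

/-- The class `𝓜` of formula occurrences over `L`: the intersection of the `𝓜_r` for the roots `r` of
the preconstructive two-node prevalent models. -/
def MM : Set (Cont L × Fm L) :=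
  {p | ∀ W : SFModel L, W.IsPrevalent → W.IsTwoNode → W.IsPreconstructive →
    MK W W.root (p.1.map (L.lhomWithConstants W.D)) (p.2.map (L.lhomWithConstants W.D))}

/-- `Φ(A) = {F[⇁B] | ⟨F, B⟩ ∈ 𝓜 and A = F[¬B]}`. -/
def Phi (A : Fm L) : Set (Fm L) :=
  {C | ∃ (F : Cont L) (B : Fm L), (F, B) ∈ MM L ∧ A = F.fill (.neg B) ∧ C = F.fill (.wneg B)}

/-- `Φ[X]`, the union of the `Φ(A)` for `A ∈ X`. -/
def PhiImage (X : Set (Fm L)) : Set (Fm L) := ⋃ A ∈ X, Phi L A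

/-- `SFQ_P`: the set of the (closed) theorems of `NSF_P`. -/
def Theorems : Set (Fm L) := {A | A.Closed ∧ NSFp ∅ A}

/-- The theorems of `NSF_P` that do not involve the combination `→ ⊥`. -/
def WnegFreeTheorems : Set (Fm L) := {A | A ∈ Theorems L ∧ A.WnegFree}

end SFQ

namespace SFQ

open FirstOrder FirstOrder.Language

/-! ### Syntax: substitution, global negative formulas, local occurrences, translations. -/

section FormulaLemmas

variable {L L' : FirstOrder.Language.{0, 0}}

/-! In a preconstructive prevalent two-node model every object exists at the leaf and none at the
root. All nodes lie below the leaf, so `→`, `¬` and `∀` take at the root the truth value they have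
at the leaf, where evaluation is classical and `¬B`, `⇁B` agree. What separates the root from the
leaf is that, by strictness, no atom of positive arity holds at the root, and no local `∃` does.
Exchanging `¬B` and `⇁B` under `F` can therefore matter at the root only through an `∃` above the
placeholder: `¬B` always lies in `GN`, `⇁B` only if `B` does, so passing from `¬` to `⇁` may turn a
global `∃` into a local, hence false, one.

Consequently `F[⇁B]` at the root always gives `F[¬B]` (`HasLeaf.sat_root_fill_neg`). The converse
holds as soon as the pair of `F` and `B` is in `𝓜_r` (`HasLeaf.sat_root_fill_wneg`), and truth of
`F[⇁B]` at the root puts it there (`HasLeaf.mk_of_sat`).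

The rest is soundness and completeness of the calculus for closed formulas at these roots
(`HasLeaf.sound`, `derivable_of_valid`). Soundness and `HasLeaf.mk_of_sat` give (i). For (ii), `Φ`
sends theorems to theorems by completeness; conversely a theorem `F[⇁B]` lies in `Φ(F[¬B])` by (i),
and `F[¬B]` is a theorem with one `→ ⊥` fewer, so induction applies.

Completeness has two halves. Under `⇁⇁` the calculus is classical, and a Henkin term model placed as
a leaf over an empty root shows that validity at the leaves gives `⊢ ⇁⇁S` (`wneg_wneg_of_valid`).
The prefix `⇁⇁` can be dropped only for `ST_P`. So `exists_isNormalForm` attaches to `A` an `S` in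
`ST_P` from which `A` is derivable and which holds at the leaf whenever `A` holds at a root without
true atoms. If `A` is valid at the roots, then `⊢ ⇁⇁S`, hence `⊢ S`, hence `⊢ A`. -/

theorem mem_varFinset_tsubst {x y : ℕ} {t s : L.Term ℕ} :
    y ∈ (tsubst x t s).varFinset ↔
      (y ∈ s.varFinset ∧ y ≠ x) ∨ (x ∈ s.varFinset ∧ y ∈ t.varFinset) := by
  induction s with
  | var z =>
    by_cases h : z = x
    · subst h; simp [tsubst, Term.subst, Term.varFinset]
    · simp [tsubst, Term.subst, Term.varFinset, h, Ne.symm h]; rintro rfl; exact h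
  | func f ts ih =>
    simp only [tsubst] at ih
    simp only [tsubst, Term.subst, Term.varFinset, Finset.mem_biUnion, Finset.mem_univ, true_and, ih]
    constructor
    · rintro ⟨i, h | h⟩
      · exact .inl ⟨⟨i, h.1⟩, h.2⟩
      · exact .inr ⟨⟨i, h.1⟩, h.2⟩
    · rintro (⟨⟨i, h⟩, h'⟩ | ⟨⟨i, h⟩, h'⟩)
      · exact ⟨i, .inl ⟨h, h'⟩⟩
      · exact ⟨i, .inr ⟨h, h'⟩⟩

theorem tsubst_of_notMem {x : ℕ} {t s : L.Term ℕ} (h : x ∉ s.varFinset) : tsubst x t s = s := by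
  induction s with
  | var z =>
    have : z ≠ x := by rintro rfl; simp [Term.varFinset] at h
    simp [tsubst, Term.subst, this]
  | func f ts ih =>
    simp only [tsubst, Term.subst] at ih ⊢
    congr 1; funext i
    exact ih i fun hi => h (by simpa [Term.varFinset] using ⟨i, hi⟩)

theorem tsubst_var_self (x : ℕ) (s : L.Term ℕ) : tsubst x (Term.var x) s = s := by
  induction s with
  | var z => by_cases h : z = x <;> simp [tsubst, Term.subst, h]
  | func f ts ih =>
    simp only [tsubst, Term.subst] at ih ⊢
    congr 1; funext i; exact ih i

theorem onTerm_tsubst (φ : L →ᴸ L') (x : ℕ) (t s : L.Term ℕ) :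
    φ.onTerm (tsubst x t s) = tsubst x (φ.onTerm t) (φ.onTerm s) := by
  induction s with
  | var z => by_cases h : z = x <;> simp [tsubst, Term.subst, h, LHom.onTerm]
  | func f ts ih =>
    simp only [tsubst, Term.subst, LHom.onTerm] at ih ⊢
    congr 1; funext i; exact ih i

theorem varFinset_onTerm (φ : L →ᴸ L') (s : L.Term ℕ) : (φ.onTerm s).varFinset = s.varFinset := by
  induction s with
  | var z => rfl
  | func f ts ih => simp [LHom.onTerm, Term.varFinset, ih]

namespace Fm

@[simp] theorem not_gn_top : ¬ GN (top : Fm L) := by intro h; cases h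
@[simp] theorem gn_bot : GN (bot : Fm L) := .bot
@[simp] theorem not_gn_rel {n : ℕ} (P : L.Relations n) (ts) : ¬ GN (rel P ts) := by
  intro h; cases h
@[simp] theorem gn_and {A B : Fm L} : GN (and A B) ↔ GN A ∧ GN B :=
  ⟨fun h => by cases h; exact ⟨‹_›, ‹_›⟩, fun h => .and h.1 h.2⟩
@[simp] theorem gn_or {A B : Fm L} : GN (or A B) ↔ GN A ∧ GN B :=
  ⟨fun h => by cases h; exact ⟨‹_›, ‹_›⟩, fun h => .or h.1 h.2⟩
@[simp] theorem gn_imp {A B : Fm L} : GN (imp A B) ↔ GN A ∧ GN B :=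
  ⟨fun h => by cases h; exact ⟨‹_›, ‹_›⟩, fun h => .imp h.1 h.2⟩
@[simp] theorem gn_neg (A : Fm L) : GN (neg A) := .neg A
@[simp] theorem gn_all {x : ℕ} {A : Fm L} : GN (all x A) ↔ GN A :=
  ⟨fun h => by cases h; assumption, fun h => .all x h⟩
@[simp] theorem gn_ex {x : ℕ} {A : Fm L} : GN (ex x A) ↔ x ∈ A.fv ∧ GN A :=
  ⟨fun h => by cases h; exact ⟨‹_›, ‹_›⟩, fun h => .ex x h.1 h.2⟩

theorem GN.not_locOcc {A : Fm L} (h : GN A) (x : ℕ) : ¬ A.LocOcc x := by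
  cases h <;> simp_all [LocOcc]

theorem LocOcc.mem_fv {A : Fm L} {x : ℕ} (h : A.LocOcc x) : x ∈ A.fv := by
  induction A with
  | top | bot | neg => exact h.elim
  | rel => exact h
  | and A B ihA ihB | or A B ihA ihB | imp A B ihA ihB =>
    simp only [fv, Finset.mem_union]
    exact h.2.imp ihA ihB
  | all y A ih | ex y A ih =>
    simp only [fv, Finset.mem_erase]
    exact ⟨h.2.1.symm, ih h.2.2⟩

theorem mem_fv_subst_iff {A : Fm L} {x y : ℕ} {t : L.Term ℕ} (hx : y ≠ x) (ht : y ∉ t.varFinset) :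
    y ∈ (A.subst x t).fv ↔ y ∈ A.fv := by
  induction A with
  | top | bot => rfl
  | rel P ts => simp [subst, fv, mem_varFinset_tsubst, hx, ht]
  | neg A ih => simpa [subst, fv] using ih
  | and A B ihA ihB | or A B ihA ihB | imp A B ihA ihB => simp [subst, fv, ihA, ihB]
  | all z A ih | ex z A ih => simp only [subst]; split_ifs <;> simp [fv, ih]

theorem fv_subst_subset (A : Fm L) (x : ℕ) (t : L.Term ℕ) :
    (A.subst x t).fv ⊆ A.fv.erase x ∪ t.varFinset := by
  induction A with
  | top | bot => simp [subst, fv]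
  | rel P ts =>
    intro y
    simp only [subst, fv, Finset.mem_biUnion, mem_varFinset_tsubst, Finset.mem_union,
      Finset.mem_erase, Finset.mem_univ, true_and]
    rintro ⟨i, h | h⟩
    · exact .inl ⟨h.2, i, h.1⟩
    · exact .inr h.2
  | neg A ih => simpa [subst, fv] using ih
  | and A B ihA ihB | or A B ihA ihB | imp A B ihA ihB =>
    intro y hy
    simp only [subst, fv, Finset.mem_union, Finset.mem_erase] at hy ⊢
    rcases hy with hy | hy
    · have := ihA hy; simp only [Finset.mem_union, Finset.mem_erase] at this; tauto
    · have := ihB hy; simp only [Finset.mem_union, Finset.mem_erase] at this; tauto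
  | all z A ih | ex z A ih =>
    intro y hy
    simp only [subst] at hy
    split_ifs at hy with h
    · subst h; simp [fv] at hy ⊢; tauto
    · simp only [fv, Finset.mem_union, Finset.mem_erase] at hy ⊢
      have := ih hy.2; simp only [Finset.mem_union, Finset.mem_erase] at this; tauto

theorem subst_of_notMem {A : Fm L} {x : ℕ} {t : L.Term ℕ} (h : x ∉ A.fv) : A.subst x t = A := by
  induction A with
  | top | bot => rfl
  | rel P ts =>
    simp only [subst]; congr 1; funext i
    exact tsubst_of_notMem fun hi => h (by simpa [fv] using ⟨i, hi⟩)
  | neg A ih => simp [subst, ih h]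
  | and A B ihA ihB | or A B ihA ihB | imp A B ihA ihB =>
    simp only [fv, Finset.mem_union, not_or] at h
    simp [subst, ihA h.1, ihB h.2]
  | all z A ih | ex z A ih =>
    simp only [subst]
    split_ifs with hz
    · rfl
    · rw [ih]
      intro hx; exact h (by simp [fv, hx, Ne.symm hz])

theorem subst_var_self (A : Fm L) (x : ℕ) : A.subst x (Term.var x) = A := by
  induction A with
  | top | bot => rfl
  | rel P ts => simp [subst, tsubst_var_self]
  | neg A ih => simp [subst, ih]
  | and A B ihA ihB | or A B ihA ihB | imp A B ihA ihB => simp [subst, ihA, ihB]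
  | all z A ih | ex z A ih => simp [subst, ih]

theorem freeFor_var_self (A : Fm L) (x : ℕ) : A.FreeFor x (Term.var x) := by
  induction A with
  | top | bot | rel => trivial
  | neg A ih => exact ih
  | and A B ihA ihB | or A B ihA ihB | imp A B ihA ihB => exact ⟨ihA, ihB⟩
  | all z A ih | ex z A ih =>
    by_cases h : z = x
    · left; simp [fv, h]
    · right; exact ⟨by simpa [Term.varFinset] using h, ih⟩

/-- Freeness matters for `∃z`: membership in `GN` requires `z` to occur in the body, and a captured
`z` in `t` could create such an occurrence. -/
theorem gn_subst {A : Fm L} {x : ℕ} {t : L.Term ℕ} (h : A.FreeFor x t) :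
    GN (A.subst x t) ↔ GN A := by
  induction A with
  | top | bot | neg => simp [subst]
  | rel => simp [subst]
  | and A B ihA ihB | or A B ihA ihB | imp A B ihA ihB => simp [subst, ihA h.1, ihB h.2]
  | all z A ih =>
    rcases h with h | h
    · rw [subst_of_notMem h]
    · simp only [subst]; split_ifs <;> simp [ih h.2]
  | ex z A ih =>
    rcases h with h | h
    · rw [subst_of_notMem h]
    · simp only [subst]; split_ifs with hz
      · rfl
      · simp [ih h.2, mem_fv_subst_iff hz h.1]

theorem locOcc_subst {A : Fm L} {x y : ℕ} {t : L.Term ℕ} (h : A.FreeFor x t) (hx : y ≠ x)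
    (ht : y ∉ t.varFinset) : (A.subst x t).LocOcc y ↔ A.LocOcc y := by
  induction A with
  | top | bot | neg => simp [subst, LocOcc]
  | rel P ts => exact mem_fv_subst_iff (A := rel P ts) hx ht
  | and A B ihA ihB | or A B ihA ihB | imp A B ihA ihB =>
    simp [subst, LocOcc, ihA h.1, ihB h.2, gn_subst h.1, gn_subst h.2]
  | all z A ih =>
    rcases h with h | h
    · rw [subst_of_notMem h]
    · simp only [subst]; split_ifs <;> simp [LocOcc, ih h.2, gn_subst h.2]
  | ex z A ih =>
    rcases h with h | h
    · rw [subst_of_notMem h]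
    · simp only [subst]; split_ifs with hz
      · rfl
      · simp [LocOcc, ih h.2, gn_subst h.2, mem_fv_subst_iff hz h.1]

theorem onlyGlobal_subst {A : Fm L} {x y : ℕ} {t : L.Term ℕ} (h : A.FreeFor x t) (hx : y ≠ x)
    (ht : y ∉ t.varFinset) : OnlyGlobal y (A.subst x t) ↔ OnlyGlobal y A := by
  rw [OnlyGlobal, OnlyGlobal, locOcc_subst h hx ht, mem_fv_subst_iff hx ht]

/-- The set of the bound variables. -/
def bv : Fm L → Finset ℕ
  | top => ∅
  | bot => ∅
  | rel _ _ => ∅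
  | and A B => A.bv ∪ B.bv
  | or A B => A.bv ∪ B.bv
  | imp A B => A.bv ∪ B.bv
  | neg A => A.bv
  | all x A => insert x A.bv
  | ex x A => insert x A.bv

theorem freeFor_of_disjoint {A : Fm L} {x : ℕ} {t : L.Term ℕ}
    (h : ∀ y ∈ A.bv, y ∉ t.varFinset) : A.FreeFor x t := by
  induction A with
  | top | bot | rel => trivial
  | neg A ih => exact ih h
  | and A B ihA ihB | or A B ihA ihB | imp A B ihA ihB =>
    simp only [bv, Finset.mem_union] at h
    exact ⟨ihA fun y hy => h y (.inl hy), ihB fun y hy => h y (.inr hy)⟩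
  | all z A ih | ex z A ih =>
    simp only [bv, Finset.mem_insert] at h
    exact .inr ⟨h z (.inl rfl), ih fun y hy => h y (.inr hy)⟩

theorem bv_subst (A : Fm L) (x : ℕ) (t : L.Term ℕ) : (A.subst x t).bv = A.bv := by
  induction A with
  | top | bot | rel => rfl
  | neg A ih => exact ih
  | and A B ihA ihB | or A B ihA ihB | imp A B ihA ihB => simp [subst, bv, ihA, ihB]
  | all z A ih | ex z A ih => simp only [subst]; split_ifs <;> simp [bv, ih]

/-- Renaming `x` to a fresh variable turns local occurrences of the latter into those of `x`. -/
theorem LocOcc.of_subst_var {A : Fm L} {x z : ℕ} (hz : z ∉ A.fv) (hb : z ∉ A.bv)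
    (h : (A.subst x (Term.var z)).LocOcc z) : A.LocOcc x := by
  induction A with
  | top | bot | neg => exact h.elim
  | rel P ts =>
    by_contra hx
    rw [subst_of_notMem hx] at h
    exact hz h
  | and A B ihA ihB | or A B ihA ihB | imp A B ihA ihB =>
    simp only [fv, bv, Finset.mem_union, not_or] at hz hb
    have fA : A.FreeFor x (Term.var z) := freeFor_of_disjoint fun y hy => by
      rintro h'; simp [Term.varFinset] at h'; exact hb.1 (h' ▸ hy)
    have fB : B.FreeFor x (Term.var z) := freeFor_of_disjoint fun y hy => by
      rintro h'; simp [Term.varFinset] at h'; exact hb.2 (h' ▸ hy)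
    simp only [subst, LocOcc, gn_and, gn_or, gn_imp, gn_subst fA, gn_subst fB] at h ⊢
    exact ⟨h.1, h.2.imp (ihA hz.1 hb.1) (ihB hz.2 hb.2)⟩
  | all w A ih =>
    simp only [bv, Finset.mem_insert, not_or] at hb
    by_cases hw : w = x
    · simp only [subst, hw, if_true] at h
      exact (hz (by simpa [fv, hw] using h.mem_fv)).elim
    have fA : A.FreeFor x (Term.var z) := freeFor_of_disjoint fun y hy => by
      rintro h'; simp [Term.varFinset] at h'; exact hb.2 (h' ▸ hy)
    simp only [subst, hw, if_false, LocOcc, gn_all, gn_subst fA] at h ⊢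
    exact ⟨h.1, hw, ih (fun h' => hz (by simp [fv, h', hb.1])) hb.2 h.2.2⟩
  | ex w A ih =>
    simp only [bv, Finset.mem_insert, not_or] at hb
    by_cases hw : w = x
    · simp only [subst, hw, if_true] at h
      exact (hz (by simpa [fv, hw] using h.mem_fv)).elim
    have fA : A.FreeFor x (Term.var z) := freeFor_of_disjoint fun y hy => by
      rintro h'; simp [Term.varFinset] at h'; exact hb.2 (h' ▸ hy)
    have hw' : w ∉ (Term.var z : L.Term ℕ).varFinset := by
      simpa [Term.varFinset] using Ne.symm hb.1
    simp only [subst, hw, if_false, LocOcc, gn_ex, gn_subst fA, mem_fv_subst_iff hw hw'] at h ⊢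
    exact ⟨h.1, hw, ih (fun h' => hz (by simp [fv, h', hb.1])) hb.2 h.2.2⟩

/-! ### Translations -/

variable (φ : L →ᴸ L')

@[simp] theorem fv_map (A : Fm L) : (A.map φ).fv = A.fv := by
  induction A <;> simp_all [map, fv, varFinset_onTerm]

@[simp] theorem gn_map {A : Fm L} : GN (A.map φ) ↔ GN A := by
  induction A <;> simp_all [map]

@[simp] theorem locOcc_map {A : Fm L} {x : ℕ} : (A.map φ).LocOcc x ↔ A.LocOcc x := by
  induction A <;> simp_all [map, LocOcc, fv, varFinset_onTerm]

@[simp] theorem onlyGlobal_map {A : Fm L} {x : ℕ} : OnlyGlobal x (A.map φ) ↔ OnlyGlobal x A := by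
  simp [OnlyGlobal]

theorem map_subst (A : Fm L) (x : ℕ) (t : L.Term ℕ) :
    (A.subst x t).map φ = (A.map φ).subst x (φ.onTerm t) := by
  induction A with
  | all z A ih | ex z A ih => simp only [subst, map]; split_ifs <;> simp [map, ih]
  | _ => simp_all [subst, map, onTerm_tsubst]

theorem freeFor_map {A : Fm L} {x : ℕ} {t : L.Term ℕ} :
    (A.map φ).FreeFor x (φ.onTerm t) ↔ A.FreeFor x t := by
  induction A <;> simp_all [map, FreeFor, fv, varFinset_onTerm]

theorem uclosure_of_closed {A : Fm L} (h : A.Closed) : A.uclosure = A := by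
  rw [Closed] at h; simp [uclosure, h]

end Fm

namespace Cont

theorem fill_map (φ : L →ᴸ L') (F : Cont L) (B : Fm L) :
    (F.fill B).map φ = (F.map φ).fill (B.map φ) := by
  induction F <;> simp_all [fill, map, Fm.map]

theorem fv_fill_wneg (F : Cont L) (B : Fm L) :
    (F.fill (.wneg B)).fv = (F.fill (.neg B)).fv := by
  induction F <;> simp_all [fill, Fm.fv, Fm.wneg]

theorem closed_fill_wneg {F : Cont L} {B : Fm L} :
    (F.fill (.wneg B)).Closed ↔ (F.fill (.neg B)).Closed := by
  simp [Fm.Closed, fv_fill_wneg]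

/-- `¬B` is always in `GN`, whereas `⇁B` is so only if `B` is; replacing `⇁B` by `¬B` can only
enlarge the set of `GN` subformulas. -/
theorem gn_fill_neg {F : Cont L} {B : Fm L} (h : Fm.GN (F.fill (.wneg B))) :
    Fm.GN (F.fill (.neg B)) := by
  induction F <;> simp_all [fill, fv_fill_wneg]

theorem locOcc_fill_wneg {F : Cont L} {B : Fm L} {x : ℕ} (h : (F.fill (.neg B)).LocOcc x) :
    (F.fill (.wneg B)).LocOcc x := by
  induction F with
  | hole => exact h.elim
  | neg => exact h.elim
  | all y F ih => exact ⟨fun h' => h.1 (gn_fill_neg (F := .all y F) h'), h.2.1, ih h.2.2⟩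
  | ex y F ih => exact ⟨fun h' => h.1 (gn_fill_neg (F := .ex y F) h'), h.2.1, ih h.2.2⟩
  | andL F A ih | orL F A ih | impL F A ih =>
    simp only [fill, Fm.LocOcc, Fm.gn_and, Fm.gn_or, Fm.gn_imp] at h ⊢
    exact ⟨fun h' => h.1 ⟨gn_fill_neg h'.1, h'.2⟩, h.2.imp_left ih⟩
  | andR A F ih | orR A F ih | impR A F ih =>
    simp only [fill, Fm.LocOcc, Fm.gn_and, Fm.gn_or, Fm.gn_imp] at h ⊢
    exact ⟨fun h' => h.1 ⟨h'.1, gn_fill_neg h'.2⟩, h.2.imp_right ih⟩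

/-- More `GN` subformulas leave fewer local occurrences. The converse fails in general, which is why
the `∃` clause of `𝓜_k` carries a condition on locality. -/
theorem onlyGlobal_fill_neg {F : Cont L} {B : Fm L} {x : ℕ}
    (h : Fm.OnlyGlobal x (F.fill (.wneg B))) : Fm.OnlyGlobal x (F.fill (.neg B)) :=
  ⟨fv_fill_wneg F B ▸ h.1, fun h' => h.2 (locOcc_fill_wneg h')⟩

theorem substFill_neg (F : Cont L) (x : ℕ) (t : L.Term ℕ) (B : Fm L) :
    F.substFill x t (.neg B) = .neg (F.substFill x t B) := by
  unfold substFill; split_ifs <;> rfl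

theorem substFill_wneg (F : Cont L) (x : ℕ) (t : L.Term ℕ) (B : Fm L) :
    F.substFill x t (.wneg B) = .wneg (F.substFill x t B) := by
  unfold substFill; split_ifs <;> rfl

end Cont

end FormulaLemmas

end SFQ

namespace SFQ

open FirstOrder FirstOrder.Language

/-! ### Forcing under substitution, and its collapse in two-node models. -/

section Semantics

variable {L : FirstOrder.Language.{0, 0}}

namespace CDModel

variable (W : CDModel L)

theorem val_congr {s s' : ℕ → W.D} {t : (L[[W.D]]).Term ℕ}
    (h : ∀ x ∈ t.varFinset, s x = s' x) : W.val s t = W.val s' t := by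
  let := W.strD W.root
  unfold val
  induction t with
  | var x => exact h x (by simp [Term.varFinset])
  | func f ts ih =>
    simp only [Term.realize]
    congr 1; funext i
    exact ih i fun x hx => h x (by simpa [Term.varFinset] using ⟨i, hx⟩)

theorem val_tsubst (s : ℕ → W.D) (x : ℕ) (t u : (L[[W.D]]).Term ℕ) :
    W.val s (tsubst x t u) = W.val (Function.update s x (W.val s t)) u := by
  let := W.strD W.root
  unfold val tsubst
  rw [Term.realize_subst]
  congr 1; funext y
  by_cases h : y = x
  · subst h; simp
  · simp [h]

@[simp] theorem val_var (s : ℕ → W.D) (x : ℕ) : W.val s (Term.var x) = s x := rfl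

@[simp] theorem val_name (s : ℕ → W.D) (d : W.D) : W.val s (name L d) = d := by
  let := W.strD W.root
  let := W.str W.root
  unfold val name
  rw [Term.realize_constants]
  rfl

end CDModel

theorem varFinset_name {D : Type} (d : D) : (name L d).varFinset = ∅ := by
  simp [name, Constants.term, Term.varFinset]

variable [HasE L]

namespace SFModel

variable (W : SFModel L)

theorem relMap_congr {k k' : W.K} (h : k ≤ k') {n : ℕ} {P : (L[[W.D]]).Relations n}
    {xs : Fin n → W.D} (H : (W.strD k).RelMap P xs) : (W.strD k').RelMap P xs := by
  rcases P with P | P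
  · exact W.v_mono h P H
  · exact isEmptyElim P

theorem sat_mono {k k' : W.K} (h : k ≤ k') {s : ℕ → W.D} {A : Fm (L[[W.D]])}
    (H : W.Sat k s A) : W.Sat k' s A := by
  induction A generalizing s with
  | top => trivial
  | bot => exact H
  | rel P ts => exact W.relMap_congr h H
  | and A B ihA ihB => exact ⟨ihA H.1, ihB H.2⟩
  | or A B ihA ihB => exact H.imp ihA ihB
  | imp A B => exact fun j hj => H j (h.trans hj)
  | neg A => exact H
  | all x A => exact fun d j hj => H d j (h.trans hj)
  | ex x A ih =>
    obtain ⟨d, hd, hA⟩ := H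
    exact ⟨d, hd.imp_right fun hE => W.v_mono h _ hE, ih hA⟩

theorem sat_congr {k : W.K} {s s' : ℕ → W.D} {A : Fm (L[[W.D]])} (h : ∀ x ∈ A.fv, s x = s' x) :
    W.Sat k s A ↔ W.Sat k s' A := by
  induction A generalizing s s' k with
  | top | bot => rfl
  | rel P ts =>
    have : (fun i => W.val s (ts i)) = fun i => W.val s' (ts i) := by
      funext i
      exact W.val_congr fun x hx => h x (by simpa [Fm.fv] using ⟨i, hx⟩)
    simp only [Sat, this]
  | and A B ihA ihB | or A B ihA ihB | imp A B ihA ihB =>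
    simp only [Fm.fv, Finset.mem_union] at h
    have hA := fun k => @ihA k s s' fun x hx => h x (.inl hx)
    have hB := fun k => @ihB k s s' fun x hx => h x (.inr hx)
    simp only [Sat, hA, hB]
  | neg A ih =>
    have hA := fun k => @ih k s s' h
    simp only [Sat, hA]
  | all y A ih | ex y A ih =>
    have hA := fun k d => @ih k (Function.update s y d) (Function.update s' y d) fun x hx => by
      by_cases hxy : x = y
      · subst hxy; simp
      · simpa [hxy] using h x (by simp [Fm.fv, hxy, hx])
    simp only [Sat, hA]

theorem sat_congr_of_closed {k : W.K} {s s' : ℕ → W.D} {A : Fm (L[[W.D]])} (h : A.Closed) :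
    W.Sat k s A ↔ W.Sat k s' A :=
  W.sat_congr fun x hx => by rw [Fm.Closed] at h; simp [h] at hx

theorem sat_update_of_notMem {k : W.K} {s : ℕ → W.D} {A : Fm (L[[W.D]])} {x : ℕ} {d : W.D}
    (h : x ∉ A.fv) : W.Sat k (Function.update s x d) A ↔ W.Sat k s A :=
  W.sat_congr fun y hy => by
    have : y ≠ x := by rintro rfl; exact h hy
    simp [this]

theorem sat_subst {k : W.K} {s : ℕ → W.D} {A : Fm (L[[W.D]])} {x : ℕ} {t : (L[[W.D]]).Term ℕ}
    (h : A.FreeFor x t) :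
    W.Sat k s (A.subst x t) ↔ W.Sat k (Function.update s x (W.val s t)) A := by
  induction A generalizing s k with
  | top | bot => rfl
  | rel P ts => simp only [Fm.subst, Sat, W.val_tsubst]
  | and A B ihA ihB | or A B ihA ihB | imp A B ihA ihB =>
    simp only [Fm.subst, Sat, ihA h.1, ihB h.2]
  | neg A ih => simp only [Fm.subst, Sat, ih h]
  | all y A ih | ex y A ih =>
    rcases h with h | h
    · rw [Fm.subst_of_notMem h, W.sat_update_of_notMem h]
    · by_cases hy : y = x
      · subst hy
        simp only [Fm.subst, if_true]
        rw [W.sat_update_of_notMem (by simp [Fm.fv])]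
      -- Without capture the substitution leaves the local or global reading of the quantifier
      -- unchanged.
      · simp only [Fm.subst, if_neg hy, Sat, Fm.onlyGlobal_subst h.2 hy h.1]
        have hA := fun k d => @ih k (Function.update s y d) h.2
        have hv : ∀ d, W.val (Function.update s y d) t = W.val s t := fun d =>
          W.val_congr fun z hz => by
            have : z ≠ y := by rintro rfl; exact h.1 hz
            simp [this]
        simp only [hA, hv, Function.update_comm (Ne.symm hy)]

theorem sat_subst_name {k : W.K} {s : ℕ → W.D} {A : Fm (L[[W.D]])} {x : ℕ} {d : W.D} :
    W.Sat k s (A.subst x (name L d)) ↔ W.Sat k (Function.update s x d) A := by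
  rw [W.sat_subst (Fm.freeFor_of_disjoint (by simp [varFinset_name])), W.val_name]

/-- Renaming a variable to a fresh one. -/
theorem sat_subst_var {k : W.K} {s : ℕ → W.D} {A : Fm (L[[W.D]])} {x z : ℕ} {d : W.D}
    (h : A.FreeFor x (Term.var z)) (hz : z ∉ (Fm.ex x A).fv) :
    W.Sat k (Function.update s z d) (A.subst x (Term.var z)) ↔
      W.Sat k (Function.update s x d) A := by
  rw [W.sat_subst h, W.val_var, Function.update_self]
  refine W.sat_congr fun y hy => ?_
  by_cases hx : y = x
  · subst hx; simp
  · have : y ≠ z := by rintro rfl; exact hz (by simp [Fm.fv, hx, hy])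
    simp [hx, this]

theorem forces_iff {k : W.K} {A : Fm (L[[W.D]])} (h : A.Closed) (s : ℕ → W.D) :
    W.Forces k A ↔ W.Sat k s A := by
  rw [Forces, Fm.uclosure_of_closed h]
  exact ⟨fun H => H s, fun H s' => (W.sat_congr_of_closed h).1 H⟩

/-! ### Two-node models -/

/-- The model consists of the root and the leaf `l`; every object exists at `l`, and none does at
the root. -/
structure HasLeaf (l : W.K) : Prop where
  eq_or_eq : ∀ k, k = W.root ∨ k = l
  full : ∀ d : W.D, (fun _ : Fin 1 => d) ∈ W.v l HasE.E
  empty : ∀ d : W.D, (fun _ : Fin 1 => d) ∉ W.v W.root HasE.E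

theorem exi_name_closed (d : W.D) : (Fm.exi (name L d)).Closed := by
  simp [Fm.Closed, Fm.exi, Fm.fv, varFinset_name]

theorem forces_exi_name {k : W.K} {d : W.D} :
    W.Forces k (Fm.exi (name L d)) ↔ (fun _ : Fin 1 => d) ∈ W.v k HasE.E := by
  rw [W.forces_iff (W.exi_name_closed d) fun _ => d]
  simp only [Fm.exi, Sat, W.val_name]
  rfl

/-- Object prevalence makes every `E(d)` true above the second node, that is, at it;
preconstructivity, applied to names, empties `E` at the root. -/
theorem exists_hasLeaf (h₁ : W.IsPrevalent) (h₂ : W.IsTwoNode) (h₃ : W.IsPreconstructive) :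
    ∃ l, W.HasLeaf l := by
  obtain ⟨l, hl, hu⟩ := (Nat.card_eq_two_iff' W.root).1 h₂
  have hc : ∀ k, k = W.root ∨ k = l := fun k => or_iff_not_imp_left.2 (hu k)
  refine ⟨l, hc, fun d => ?_, fun d hd => ?_⟩
  · obtain ⟨k, hk, hf⟩ := h₁.2 d l
    rw [W.forces_exi_name] at hf
    rcases hc k with rfl | rfl
    · exact (hl (le_antisymm hk (W.root_le l))).elim
    · exact hf
  · exact h₃ (name L d) (varFinset_name d) (W.forces_exi_name.2 hd)

namespace HasLeaf

variable {W} {l : W.K} (H : W.HasLeaf l) {s : ℕ → W.D} {A B : Fm (L[[W.D]])} {x : ℕ} {k : W.K}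
include H

theorem le_leaf (k : W.K) : k ≤ l := by
  rcases H.eq_or_eq k with rfl | rfl
  · exact W.root_le _
  · exact le_rfl

theorem eq_of_le (h : l ≤ k) : k = l := le_antisymm (H.le_leaf k) h

/-- Every node is below the leaf, so "at some later node" amounts to "at the leaf"; the node `k`
plays no role. -/
theorem sat_imp : W.Sat k s (.imp A B) ↔ (W.Sat l s A → W.Sat l s B) := by
  constructor
  · intro h hA
    obtain ⟨j, hj, hB⟩ := h l (H.le_leaf k) hA
    rwa [← H.eq_of_le hj]
  · intro h j hj hA
    exact ⟨l, H.le_leaf j, h (W.sat_mono (H.le_leaf j) hA)⟩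

theorem sat_wneg : W.Sat k s (.wneg A) ↔ ¬ W.Sat l s A := H.sat_imp

theorem sat_neg : W.Sat k s (.neg A) ↔ ¬ W.Sat l s A :=
  ⟨fun h => h l, fun h j hj => h (W.sat_mono (H.le_leaf j) hj)⟩

theorem sat_wneg_wneg : W.Sat k s (.wneg (.wneg A)) ↔ W.Sat l s A := by
  rw [H.sat_wneg, H.sat_wneg, not_not]

theorem sat_all : W.Sat k s (.all x A) ↔ ∀ d, W.Sat l (Function.update s x d) A := by
  constructor
  · intro h d
    obtain ⟨j, hj, hA⟩ := h d l (H.le_leaf k) (.inr (H.full d))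
    rwa [← H.eq_of_le hj]
  · exact fun h d j hj _ => ⟨l, H.le_leaf j, h d⟩

theorem sat_ex_leaf : W.Sat l s (.ex x A) ↔ ∃ d, W.Sat l (Function.update s x d) A :=
  ⟨fun ⟨d, _, h⟩ => ⟨d, h⟩, fun ⟨d, h⟩ => ⟨d, .inr (H.full d), h⟩⟩

theorem sat_ex_root : W.Sat W.root s (.ex x A) ↔
    Fm.OnlyGlobal x A ∧ ∃ d, W.Sat W.root (Function.update s x d) A :=
  ⟨fun ⟨d, hd, h⟩ => ⟨hd.resolve_right (H.empty d), d, h⟩, fun ⟨hg, d, h⟩ => ⟨d, .inl hg, h⟩⟩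

/-- Implications and universal formulas are decided at the leaf, so no induction is needed for them.
An `∃` in `GN` is global, hence asks for no `E(d)` at `k`. -/
theorem sat_of_leaf_of_gn (hA : Fm.GN A) (h : W.Sat l s A) : W.Sat k s A := by
  induction hA generalizing s k with
  | bot => exact h
  | neg => exact h
  | and _ _ ih₁ ih₂ => exact ⟨ih₁ h.1, ih₂ h.2⟩
  | or _ _ ih₁ ih₂ => exact h.imp ih₁ ih₂
  | imp => rw [H.sat_imp] at h ⊢; exact h
  | all => rw [H.sat_all] at h ⊢; exact h
  | ex x hx hN ih =>
    obtain ⟨d, _, h⟩ := h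
    exact ⟨d, .inl ⟨hx, hN.not_locOcc x⟩, ih h⟩

theorem sat_of_leaf_of_st (hA : Fm.ST A) (h : W.Sat l s A) : W.Sat k s A := by
  induction hA with
  | top => trivial
  | gn hN => exact H.sat_of_leaf_of_gn hN h
  | and _ _ ih₁ ih₂ => exact ⟨ih₁ h.1, ih₂ h.2⟩
  | or_gn _ hN ih => exact h.imp ih (H.sat_of_leaf_of_gn hN)
  | gn_or hN _ ih => exact h.imp (H.sat_of_leaf_of_gn hN) ih
  | imp => rw [H.sat_imp] at h ⊢; exact h
  | all => rw [H.sat_all] at h ⊢; exact h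

/-- This validates the rule from `⇁⇁S` to `S`, since `⇁⇁S` at any node is truth of `S` at the leaf.
-/
theorem sat_of_leaf_of_stp (hA : Fm.STP A) (h : W.Sat l s A) : W.Sat k s A := by
  induction hA generalizing s with
  | st hS => exact H.sat_of_leaf_of_st hS h
  | or _ _ ih₁ ih₂ => exact h.imp ih₁ ih₂
  | ex x hx _ ih =>
    obtain ⟨d, _, h⟩ := h
    exact ⟨d, .inl hx, ih h⟩

end HasLeaf

end SFModel

end Semantics

end SFQ

namespace SFQ

open FirstOrder FirstOrder.Language

/-! ### Soundness in two-node models, and the exchange of `¬` and `⇁`. -/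

section Soundness

variable {L : FirstOrder.Language.{0, 0}}

/-- The translation of an `L`-formula into the language `L(D)` of a model. -/
abbrev Fm.lift (D : Type) (A : Fm L) : Fm (L[[D]]) := A.map (L.lhomWithConstants D)

theorem Fm.freeFor_lift {A : Fm L} {x : ℕ} {t : L.Term ℕ} (D : Type) (h : A.FreeFor x t) :
    (A.lift D).FreeFor x ((L.lhomWithConstants D).onTerm t) :=
  (Fm.freeFor_map _).2 h

theorem Fm.ST.lift {A : Fm L} (h : A.ST) (D : Type) : (A.lift D).ST := by
  induction h with
  | top => exact .top
  | gn h => exact .gn ((Fm.gn_map _).2 h)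
  | and _ _ ih₁ ih₂ => exact .and ih₁ ih₂
  | or_gn _ h ih => exact .or_gn ih ((Fm.gn_map _).2 h)
  | gn_or h _ ih => exact .gn_or ((Fm.gn_map _).2 h) ih
  | imp => exact .imp _ _
  | all => exact .all _ _

theorem Fm.STP.lift {A : Fm L} (h : A.STP) (D : Type) : (A.lift D).STP := by
  induction h with
  | st h => exact .st (h.lift D)
  | or _ _ ih₁ ih₂ => exact .or ih₁ ih₂
  | ex x h _ ih => exact .ex x ((Fm.onlyGlobal_map _).2 h) ih

variable [HasE L]

namespace SFModel

variable {W : SFModel L}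

theorem sat_lift_subst {k : W.K} {s : ℕ → W.D} {A : Fm L} {x : ℕ} {t : L.Term ℕ}
    (h : A.FreeFor x t) : W.Sat k s ((A.subst x t).lift W.D) ↔
      W.Sat k (Function.update s x (W.val s ((L.lhomWithConstants W.D).onTerm t))) (A.lift W.D) := by
  rw [Fm.lift, Fm.map_subst, W.sat_subst (Fm.freeFor_lift _ h)]

theorem sat_lift_subst_var {k : W.K} {s : ℕ → W.D} {A : Fm L} {x z : ℕ} {d : W.D}
    (h : A.FreeFor x (Term.var z)) (hz : z ∉ (Fm.ex x A).fv) :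
    W.Sat k (Function.update s z d) ((A.subst x (Term.var z)).lift W.D) ↔
      W.Sat k (Function.update s x d) (A.lift W.D) := by
  rw [Fm.lift, Fm.map_subst]
  refine W.sat_subst_var (Fm.freeFor_lift _ h) ?_
  rw [← Fm.fv_map (L.lhomWithConstants W.D)] at hz
  exact hz

theorem sat_exi {k : W.K} {s : ℕ → W.D} {t : L.Term ℕ} :
    W.Sat k s ((Fm.exi t).lift W.D) ↔
      (fun _ : Fin 1 => W.val s ((L.lhomWithConstants W.D).onTerm t)) ∈ W.v k HasE.E :=
  Iff.rfl

/-- Strictness makes every argument of a true atom exist, and nothing exists at the root. Nullary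
predicates may still hold there. -/
theorem HasLeaf.empty_of_mem {l : W.K} (H : W.HasLeaf l) {n : ℕ} {P : L.Relations n}
    {xs : Fin n → W.D} (h : xs ∈ W.v W.root P) : n = 0 := by
  by_contra hn
  have i : Fin n := ⟨0, Nat.pos_of_ne_zero hn⟩
  have := W.strictness W.root P (fun i => name L (xs i)) (fun _ => xs i)
    (fun i => varFinset_name (xs i)) (by simpa using h) i _ (.refl _)
  rw [CDModel.val_name] at this
  exact H.empty _ this

theorem sat_of_mem_v {l : W.K} (H : W.HasLeaf l) {k : W.K} {n : ℕ} {P : L.Relations n}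
    {xs : Fin n → W.D} (h : xs ∈ W.v k P) (d : W.D) (hn : n ≠ 0) :
    (fun _ : Fin 1 => d) ∈ W.v k HasE.E := by
  rcases H.eq_or_eq k with rfl | rfl
  · exact (hn (H.empty_of_mem h)).elim
  · exact H.full d

/-- Soundness with respect to the preconstructive prevalent models with two nodes. -/
theorem HasLeaf.sound {l : W.K} (H : W.HasLeaf l) {Γ : Set (Fm L)} {A : Fm L} (h : NSFp Γ A)
    (k : W.K) (s : ℕ → W.D) (hΓ : ∀ B ∈ Γ, W.Sat k s (B.lift W.D)) : W.Sat k s (A.lift W.D) := by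
  have ins : ∀ {Γ : Set (Fm L)} {k : W.K} {s : ℕ → W.D} {A : Fm L}, W.Sat k s (A.lift W.D) →
      (∀ B ∈ Γ, W.Sat k s (B.lift W.D)) → ∀ B ∈ insert A Γ, W.Sat k s (B.lift W.D) := by
    rintro Γ k s A hA hΓ B (rfl | hB)
    exacts [hA, hΓ B hB]
  have upd : ∀ {Γ : Set (Fm L)} {k : W.K} {s : ℕ → W.D} {x : ℕ} (d : W.D), (∀ B ∈ Γ, x ∉ B.fv) →
      (∀ B ∈ Γ, W.Sat k s (B.lift W.D)) →
      ∀ B ∈ Γ, W.Sat k (Function.update s x d) (B.lift W.D) := by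
    intro Γ k s x d hx hΓ B hB
    rw [W.sat_update_of_notMem (by simpa using hx B hB)]
    exact hΓ B hB
  induction h generalizing k s with
  | hyp hA => exact hΓ _ hA
  | weaken hs _ ih => exact ih k s fun B hB => hΓ B (hs hB)
  | andI _ _ ih₁ ih₂ => exact ⟨ih₁ k s hΓ, ih₂ k s hΓ⟩
  | andE₁ _ ih => exact (ih k s hΓ).1
  | andE₂ _ ih => exact (ih k s hΓ).2
  | orI₁ _ ih => exact .inl (ih k s hΓ)
  | orI₂ _ ih => exact .inr (ih k s hΓ)
  | orE _ _ _ ih ih₁ ih₂ =>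
    rcases ih k s hΓ with h | h
    · exact ih₁ k s (ins h hΓ)
    · exact ih₂ k s (ins h hΓ)
  | topI => trivial
  | botE _ ih => exact (ih k s hΓ).elim
  | @str₁ _ n P ts i _ ih =>
    have h : (fun i => _) ∈ W.v k P := ih k s hΓ
    exact sat_of_mem_v H h _ (by rintro rfl; exact i.elim0)
  | str₂ i _ ih =>
    exact sat_of_mem_v H (P := HasE.E) (ih k s hΓ) _ one_ne_zero
  | stp hS _ ih => exact H.sat_of_leaf_of_stp (hS.lift W.D) (H.sat_wneg_wneg.1 (ih k s hΓ))
  | impI _ ih =>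
    -- The premise is used at the leaf, to which the hypotheses persist.
    refine H.sat_imp.2 fun hA => H.sat_wneg_wneg.1 (ih l s (ins hA fun B hB => ?_))
    exact W.sat_mono (H.le_leaf k) (hΓ B hB)
  | impE _ _ ih₁ ih₂ =>
    exact H.sat_wneg_wneg.2 (H.sat_imp.1 (ih₁ k s hΓ) (W.sat_mono (H.le_leaf k) (ih₂ k s hΓ)))
  | negI _ ih => exact H.sat_neg.2 (H.sat_wneg.1 (ih k s hΓ))
  | negE _ _ ih₁ ih₂ => exact ih₁ k s hΓ k (ih₂ k s hΓ)
  | dne A => exact H.sat_imp.2 fun h => not_not.1 fun hA => H.sat_neg.1 h (H.sat_neg.2 hA)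
  | obj x => exact H.sat_all.2 fun d => H.sat_neg.2 fun h => H.sat_neg.1 h (H.full _)
  | allI hx _ ih => exact H.sat_all.2 fun d => H.sat_wneg_wneg.1 (ih k _ (upd d hx hΓ))
  | allE t ht _ ih =>
    exact H.sat_wneg_wneg.2 ((sat_lift_subst ht).2 (H.sat_all.1 (ih k s hΓ) _))
  | exGloI t ht hg _ ih =>
    exact ⟨_, .inl ((Fm.onlyGlobal_map _).2 hg), (sat_lift_subst ht).1 (ih k s hΓ)⟩
  | exLocI t ht _ _ _ ih ihE =>
    exact ⟨_, .inr (ihE k s hΓ), (sat_lift_subst ht).1 (ih k s hΓ)⟩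
  | @exGloE _ x y A C hf hg hx hC hB _ _ ih₁ ih₂ =>
    obtain ⟨d, -, hd⟩ := ih₁ k s hΓ
    -- The eigenvariable is assigned the witness `d`; it is free neither in `C` nor in the
    -- hypotheses, so they keep their values.
    rw [← W.sat_update_of_notMem (by simpa using hC) (d := d)]
    exact ih₂ k _ (ins ((sat_lift_subst_var hf hx).2 hd) (upd d hB hΓ))
  | @exLocE _ x y A C hf hg hx hC hB _ _ ih₁ ih₂ =>
    obtain ⟨d, hE, hd⟩ := ih₁ k s hΓ
    rw [← W.sat_update_of_notMem (by simpa using hC) (d := d)]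
    refine ih₂ k _ (ins ((sat_lift_subst_var hf hx).2 hd) (ins ?_ (upd d hB hΓ)))
    rw [sat_exi]
    simpa [LHom.onTerm] using hE.resolve_left (by simpa using hg)

/-! ### Occurrences of `⇁` -/

/-- Truth of `F[⇁B]` supplies the required clause at each step: the true disjunct at `∨`, and at `∃`
the truth of the whole formula, which at the root forces the quantification to be global. -/
theorem HasLeaf.mk_of_sat {l : W.K} (H : W.HasLeaf l) {F : Cont (L[[W.D]])} {B : Fm (L[[W.D]])}
    (hc : (F.fill (.wneg B)).Closed) {s : ℕ → W.D}
    (h : W.Sat W.root s (F.fill (.wneg B))) : MK W W.root F B := by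
  induction F with
  | hole => exact .hole B
  | andL F A ih =>
    exact .andL _ _ _ (ih (Finset.union_eq_empty.1 hc).1 h.1)
  | andR A F ih =>
    exact .andR _ _ _ (ih (Finset.union_eq_empty.1 hc).2 h.2)
  | orL F A ih =>
    obtain ⟨h₁, h₂⟩ := Finset.union_eq_empty.1 hc
    rcases h with h | h
    · exact .orL _ _ _ (ih h₁ h)
    · exact .orL_forced _ _ _ ((W.forces_iff h₂ s).2 h)
  | orR A F ih =>
    obtain ⟨h₁, h₂⟩ := Finset.union_eq_empty.1 hc
    rcases h with h | h
    · exact .orR_forced _ _ _ ((W.forces_iff h₁ s).2 h)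
    · exact .orR _ _ _ (ih h₂ h)
  | impL => exact .impL _ _ _
  | impR => exact .impR _ _ _
  | neg => exact .neg _ _
  | all => exact .all _ _ _
  | ex x F =>
    exact .ex_forced _ _ _ (.inr (H.sat_ex_root.1 h).1) ((W.forces_iff hc s).2 h)

/-- The leaf is classical: `¬` and `⇁` coincide there, and since all objects exist the distinction
of local and global disappears. -/
theorem HasLeaf.sat_leaf_fill {l : W.K} (H : W.HasLeaf l) (F : Cont (L[[W.D]])) (B : Fm (L[[W.D]]))
    (s : ℕ → W.D) : W.Sat l s (F.fill (.wneg B)) ↔ W.Sat l s (F.fill (.neg B)) := by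
  induction F generalizing s with
  | hole => exact H.sat_wneg.trans H.sat_neg.symm
  | andL F A ih | andR A F ih | orL F A ih | orR A F ih => simp only [Cont.fill, Sat, ih]
  | impL F A ih | impR A F ih => simp only [Cont.fill, H.sat_imp, ih]
  | neg F ih => simp only [Cont.fill, H.sat_neg, ih]
  | all x F ih => simp only [Cont.fill, H.sat_all, ih]
  | ex x F ih => simp only [Cont.fill, H.sat_ex_leaf, ih]

theorem HasLeaf.sat_root_fill_neg {l : W.K} (H : W.HasLeaf l) {F : Cont (L[[W.D]])}
    {B : Fm (L[[W.D]])} {s : ℕ → W.D} (h : W.Sat W.root s (F.fill (.wneg B))) :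
    W.Sat W.root s (F.fill (.neg B)) := by
  induction F generalizing s with
  | hole => exact H.sat_neg.2 (H.sat_wneg.1 h)
  | andL F A ih => exact h.imp_left ih
  | andR A F ih => exact h.imp_right ih
  | orL F A ih => exact h.imp_left ih
  | orR A F ih => exact h.imp_right ih
  | impL F A | impR A F =>
    simp only [Cont.fill, H.sat_imp, H.sat_leaf_fill] at h ⊢; exact h
  | neg F => simp only [Cont.fill, H.sat_neg, H.sat_leaf_fill] at h ⊢; exact h
  | all x F => simp only [Cont.fill, H.sat_all, H.sat_leaf_fill] at h ⊢; exact h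
  | ex x F ih =>
    obtain ⟨hg, d, hd⟩ := H.sat_ex_root.1 h
    exact H.sat_ex_root.2 ⟨Cont.onlyGlobal_fill_neg hg, d, ih hd⟩

theorem HasLeaf.sat_root_fill_wneg {l : W.K} (H : W.HasLeaf l) {F : Cont (L[[W.D]])}
    {B : Fm (L[[W.D]])} (hm : MK W W.root F B) (hc : (F.fill (.neg B)).Closed) {s : ℕ → W.D}
    (h : W.Sat W.root s (F.fill (.neg B))) : W.Sat W.root s (F.fill (.wneg B)) := by
  induction hm generalizing s with
  | hole => exact H.sat_wneg.2 (H.sat_neg.1 h)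
  | impL | impR => simp only [Cont.fill, H.sat_imp, H.sat_leaf_fill] at h ⊢; exact h
  | neg => simp only [Cont.fill, H.sat_neg, H.sat_leaf_fill] at h ⊢; exact h
  | all => simp only [Cont.fill, H.sat_all, H.sat_leaf_fill] at h ⊢; exact h
  | andL _ _ _ _ ih => exact h.imp_left (ih (Finset.union_eq_empty.1 hc).1)
  | andR _ _ _ _ ih => exact h.imp_right (ih (Finset.union_eq_empty.1 hc).2)
  | orL _ _ _ _ ih => exact h.imp_left (ih (Finset.union_eq_empty.1 hc).1)
  | orR _ _ _ _ ih => exact h.imp_right (ih (Finset.union_eq_empty.1 hc).2)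
  | orL_forced _ _ _ hf => exact .inr ((W.forces_iff (Finset.union_eq_empty.1 hc).2 s).1 hf)
  | orR_forced _ _ _ hf => exact .inl ((W.forces_iff (Finset.union_eq_empty.1 hc).1 s).1 hf)
  | ex_inst x F B hg _ ih =>
    obtain ⟨hn, d, hd⟩ := H.sat_ex_root.1 h
    have hc' : ((F.fill (.neg B)).subst x (name L d)).Closed := by
      refine Finset.subset_empty.1 ((Fm.fv_subst_subset _ _ _).trans ?_)
      rw [varFinset_name, Finset.union_empty]
      exact Finset.subset_empty.2 hc
    have hd' := W.sat_subst_name.2 hd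
    -- Truth of `∃x F[¬B]` at the root makes it global (`hn`), so the locality condition of `𝓜_r`
    -- leaves only the case that `∃x F[⇁B]` is global. The same witness `d` then serves.
    refine H.sat_ex_root.2 ⟨hg.resolve_left (not_not.2 hn), d, ?_⟩
    rw [← W.sat_subst_name, Cont.fill_subst, Cont.substFill_wneg]
    refine ih d ((W.forces_iff hc' _).2 hd') ?_ ?_
    · rw [← Cont.substFill_neg, ← Cont.fill_subst]; exact hc'
    · rw [← Cont.substFill_neg, ← Cont.fill_subst]; exact hd'
  | ex_forced x F B hg hf =>
    exact (W.forces_iff (Cont.closed_fill_wneg (F := .ex x F) |>.2 hc) s).1 hf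

end SFModel

end Soundness

end SFQ

namespace SFQ

open FirstOrder FirstOrder.Language

/-! ### Derived rules, classical behaviour under `⇁⇁`, and Henkin sets. -/

section Calculus

variable {L : FirstOrder.Language.{0, 0}} [HasE L]

namespace NSFp

open Fm

variable {Γ Δ : Set (Fm L)} {A B C : Fm L} {x z : ℕ}

theorem head : NSFp (insert A Γ) A := .hyp (Set.mem_insert _ _)

/-- Eliminating `A ∨ A` simulates a cut; a detour through `A → C` would yield only `⇁⇁C`. -/
theorem cut (h : NSFp Γ A) (h' : NSFp (insert A Γ) C) : NSFp Γ C := .orE (.orI₁ h) h' h'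

/-- Modus ponens gives only `⇁⇁⊥`, but `⊥` is in `GN` and hence stable. -/
theorem of_wneg (h : NSFp Γ (wneg A)) (h' : NSFp Γ A) : NSFp Γ bot :=
  .stp (.st (.gn .bot)) (.impE h h')

theorem wnegI (h : NSFp (insert A Γ) bot) : NSFp Γ (wneg A) := .impI (.botE h)

theorem wneg_wneg (h : NSFp Γ A) : NSFp Γ (wneg (wneg A)) :=
  wnegI (of_wneg head (.weaken (Set.subset_insert _ _) h))

theorem bot_of_wneg_wneg (h : NSFp Γ (wneg (wneg A))) (h' : NSFp (insert A Γ) bot) :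
    NSFp Γ bot :=
  of_wneg h (wnegI h')

/-- Instantiating `∀x ¬¬E(x)` gives `⇁⇁¬¬E(t)`; the formula `¬¬E(t)` is in `GN`, so `⇁⇁` drops, and
the axiom `¬¬E(t) → E(t)` finishes. -/
theorem wneg_wneg_exi (t : L.Term ℕ) : NSFp Γ (wneg (wneg (exi t))) := by
  have h : NSFp Γ (wneg (wneg (neg (neg ((exi (Term.var 0)).subst 0 t))))) :=
    .allE (x := 0) t (by exact trivial) (.obj 0)
  have e : (exi (Term.var 0) : Fm L).subst 0 t = exi t := by
    simp [exi, subst, tsubst, Term.subst]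
  rw [e] at h
  exact .impE (.dne _) (.stp (.st (.gn (.neg _))) h)

/-- Under `⇁⇁` the premise `E(t)` of the local introduction comes for free, so local and global `∃`
behave alike. -/
theorem wneg_wneg_ex {t : L.Term ℕ} (ht : A.FreeFor x t) (h : NSFp Γ (A.subst x t)) :
    NSFp Γ (wneg (wneg (ex x A))) := by
  by_cases hg : OnlyGlobal x A
  · exact wneg_wneg (.exGloI t ht hg h)
  · refine wnegI (bot_of_wneg_wneg (wneg_wneg_exi t) (of_wneg (A := ex x A) (.hyp (by simp)) ?_))
    refine .exLocI t ht hg (.weaken ?_ h) head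
    exact (Set.subset_insert _ _).trans (Set.subset_insert _ _)

theorem exE (hf : A.FreeFor x (Term.var z)) (hz : z ∉ (ex x A).fv) (hC : z ∉ C.fv)
    (hΓ : ∀ B ∈ Γ, z ∉ B.fv) (h : NSFp Γ (ex x A))
    (h' : NSFp (insert (A.subst x (Term.var z)) Γ) C) : NSFp Γ C := by
  by_cases hg : OnlyGlobal x A
  · exact .exGloE hf hg hz hC hΓ h h'
  · exact .exLocE hf hg hz hC hΓ h (.weaken (Set.insert_subset_insert (Set.subset_insert _ _)) h')

theorem wneg_wneg_ex_of_wneg_all (h : NSFp Γ (wneg (all x A))) :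
    NSFp Γ (wneg (wneg (ex x (wneg A)))) := by
  -- Deriving `∀x A` from this single hypothesis, where `x` is bound, keeps the eigenvariable
  -- condition away from `Γ`.
  have h' : NSFp {wneg (ex x (wneg A))} (all x A) := by
    refine .allI (by simp [wneg, fv]) (wnegI ?_)
    refine bot_of_wneg_wneg (wneg_wneg_ex (t := Term.var x) (freeFor_var_self (wneg A) x) ?_)
      (of_wneg (A := ex x (wneg A)) (.hyp (by simp)) head)
    rw [subst_var_self]
    exact head
  exact wnegI (of_wneg (.weaken (Set.subset_insert _ _) h) (.weaken (by simp) h'))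

end NSFp

/-- Complete consistent sets in which existential formulas are witnessed by variables `≥ N`. -/
structure IsHenkin (N : ℕ) (T : Set (Fm L)) : Prop where
  mem_of_derivable : ∀ Δ ⊆ T, Δ.Finite → ∀ A : Fm L, NSFp Δ (.wneg (.wneg A)) → A ∈ T
  bot_notMem : Fm.bot ∉ T
  wneg_mem : ∀ A ∉ T, Fm.wneg A ∈ T
  exists_witness : ∀ x A, Fm.ex x A ∈ T → ∃ z ≥ N, A.subst x (Term.var z) ∈ T

/-- Finite consistent sets of formulas, ordered by inclusion. -/
abbrev FinCons (L : FirstOrder.Language.{0, 0}) [HasE L] : Type :=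
  {Γ : Set (Fm L) // Γ.Finite ∧ ¬ NSFp Γ .bot}

/-- The density step of the Henkin construction. If `A` is refutable from `Γ`, then `⇁A` is added;
otherwise `A` is added, with a fresh variable as witness when it is existential. -/
theorem FinCons.exists_decides (N : ℕ) (Γ : FinCons L) (A : Fm L) :
    ∃ Δ : FinCons L, Γ ≤ Δ ∧ (A ∈ Δ.1 ∨ Fm.wneg A ∈ Δ.1) ∧
      ∀ x B, A = .ex x B → A ∈ Δ.1 → ∃ z ≥ N, B.subst x (Term.var z) ∈ Δ.1 := by
  obtain ⟨Γ, hfin, hcons⟩ := Γ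
  by_cases hA : NSFp (insert A Γ) .bot
  · have h' : ¬ NSFp (insert (Fm.wneg A) Γ) .bot := fun h =>
      hcons (NSFp.of_wneg (NSFp.wnegI h) (NSFp.wnegI hA))
    refine ⟨⟨insert (Fm.wneg A) Γ, hfin.insert _, h'⟩, Set.subset_insert _ _, .inr (by simp), ?_⟩
    intro x B _ hm
    exact (h' (NSFp.of_wneg NSFp.head (.hyp hm))).elim
  · by_cases hex : ∃ x B, A = .ex x B
    · obtain ⟨x, B, rfl⟩ := hex
      -- Avoiding `B.bv` makes `z` free for `x` in `B`; the other exclusions give `z ≥ N` and the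
      -- eigenvariable conditions.
      obtain ⟨z, hz⟩ := Infinite.exists_notMem_finset
        (Finset.range N ∪ B.bv ∪ (Fm.ex x B).fv ∪ hfin.toFinset.biUnion Fm.fv)
      simp only [Finset.mem_union, not_or, Finset.mem_range, not_lt, Finset.mem_biUnion,
        Set.Finite.mem_toFinset, not_exists, not_and] at hz
      obtain ⟨⟨⟨hN, hb⟩, hfv⟩, hΓ⟩ := hz
      refine ⟨⟨insert (B.subst x (Term.var z)) (insert (.ex x B) Γ), (hfin.insert _).insert _, ?_⟩,
        ?_, .inl (by simp), ?_⟩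
      · intro h
        refine hA (NSFp.exE (Fm.freeFor_of_disjoint ?_) hfv (by simp [Fm.fv]) ?_ NSFp.head h)
        · intro y hy hyz
          simp only [Term.varFinset, Finset.mem_singleton] at hyz
          exact hb (hyz ▸ hy)
        · rintro C (rfl | hC)
          · exact hfv
          · exact hΓ C hC
      · exact (Set.subset_insert _ _).trans (Set.subset_insert _ _)
      · rintro y C e -
        cases e
        exact ⟨z, hN, by simp⟩
    · refine ⟨⟨insert A Γ, hfin.insert _, hA⟩, Set.subset_insert _ _, .inl (by simp), ?_⟩
      intro x B e
      exact (hex ⟨x, B, e⟩).elim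

/-- Rasiowa–Sikorski: there are countably many formulas, so an ideal of finite consistent sets can
decide and witness all of them; `T` is its union. Directedness puts each finite subset of `T` inside
one consistent member. -/
theorem exists_isHenkin [Countable (Fm L)] (N : ℕ) {Γ : Set (Fm L)} (hfin : Γ.Finite)
    (hcons : ¬ NSFp Γ .bot) : ∃ T, Γ ⊆ T ∧ IsHenkin N T := by
  classical
  have := Encodable.ofCountable (Fm L)
  let 𝒟 : Fm L → Order.Cofinal (FinCons L) := fun A =>
    ⟨{Δ | (A ∈ Δ.1 ∨ Fm.wneg A ∈ Δ.1) ∧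
      ∀ x B, A = .ex x B → A ∈ Δ.1 → ∃ z ≥ N, B.subst x (Term.var z) ∈ Δ.1}, fun Γ => by
        obtain ⟨Δ, h, h'⟩ := FinCons.exists_decides N Γ A
        exact ⟨Δ, h', h⟩⟩
  let I := Order.idealOfCofinals (⟨Γ, hfin, hcons⟩ : FinCons L) 𝒟
  let T : Set (Fm L) := {A | ∃ Δ ∈ I, A ∈ Δ.1}
  have hsub : ∀ S : Set (Fm L), S.Finite → S ⊆ T → ∃ Δ ∈ I, S ⊆ Δ.1 := by
    intro S hS
    induction S, hS using Set.Finite.induction_on with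
    | empty => exact fun _ => ⟨_, Order.mem_idealOfCofinals _ 𝒟, Set.empty_subset _⟩
    | insert _ _ ih =>
      intro h
      obtain ⟨Δ₁, hI₁, h₁⟩ := h (Set.mem_insert _ _)
      obtain ⟨Δ₂, hI₂, h₂⟩ := ih ((Set.subset_insert _ _).trans h)
      obtain ⟨Δ, hI, hle₁, hle₂⟩ := I.directed _ hI₁ _ hI₂
      exact ⟨Δ, hI, Set.insert_subset (hle₁ h₁) (h₂.trans hle₂)⟩
  have hdec : ∀ A, A ∈ T ∨ Fm.wneg A ∈ T := fun A => by
    obtain ⟨Δ, ⟨h, -⟩, hI⟩ := Order.cofinal_meets_idealOfCofinals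
      (⟨Γ, hfin, hcons⟩ : FinCons L) 𝒟 A
    exact h.imp (fun h => ⟨Δ, hI, h⟩) (fun h => ⟨Δ, hI, h⟩)
  have hcT : ∀ S : Set (Fm L), S.Finite → S ⊆ T → ¬ NSFp S .bot := fun S hS hST h => by
    obtain ⟨Δ, -, hSΔ⟩ := hsub S hS hST
    exact Δ.2.2 (.weaken hSΔ h)
  refine ⟨T, fun A hA => ⟨_, Order.mem_idealOfCofinals _ 𝒟, hA⟩, ?_, ?_, ?_, ?_⟩
  · intro Δ hΔ hΔf A h
    refine (hdec A).resolve_right fun hA => ?_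
    exact hcT (insert (Fm.wneg A) Δ) (hΔf.insert _) (Set.insert_subset hA hΔ)
      (NSFp.of_wneg (.weaken (Set.subset_insert _ _) h) NSFp.head)
  · exact fun h => hcT {.bot} (Set.finite_singleton _) (by simpa using h) (.hyp rfl)
  · exact fun A hA => (hdec A).resolve_left hA
  · intro x A hA
    obtain ⟨Δ, ⟨h, hw⟩, hI⟩ := Order.cofinal_meets_idealOfCofinals
      (⟨Γ, hfin, hcons⟩ : FinCons L) 𝒟 (.ex x A)
    have hm : Fm.ex x A ∈ Δ.1 := by
      refine h.resolve_right fun h => ?_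
      refine hcT {.ex x A, .wneg (.ex x A)} (by simp) ?_
        (NSFp.of_wneg (A := .ex x A) (.hyp (by simp)) (.hyp (by simp)))
      rintro B (rfl | rfl)
      · exact hA
      · exact ⟨Δ, hI, h⟩
    obtain ⟨z, hz, hz'⟩ := hw x A rfl hm
    exact ⟨z, hz, Δ, hI, hz'⟩

namespace IsHenkin

open Fm

variable {N : ℕ} {T : Set (Fm L)} (hT : IsHenkin N T) {A B : Fm L} {x : ℕ}
include hT

theorem mem_of_nil (h : NSFp ∅ (wneg (wneg A))) : A ∈ T :=
  hT.mem_of_derivable ∅ (Set.empty_subset _) Set.finite_empty A h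

theorem mem_of_mem (hA : A ∈ T) (h : NSFp {A} (wneg (wneg B))) : B ∈ T :=
  hT.mem_of_derivable {A} (by simpa using hA) (Set.finite_singleton _) B h

theorem mem_of_mem₂ {C : Fm L} (hA : A ∈ T) (hB : B ∈ T) (h : NSFp {A, B} (wneg (wneg C))) :
    C ∈ T :=
  hT.mem_of_derivable {A, B} (Set.insert_subset hA (by simpa using hB)) (by simp) C h

theorem wneg_mem_iff : wneg A ∈ T ↔ A ∉ T := by
  refine ⟨fun h hA => hT.bot_notMem (hT.mem_of_mem₂ h hA (NSFp.wneg_wneg ?_)), hT.wneg_mem A⟩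
  exact NSFp.of_wneg (A := A) (.hyp (by simp)) (.hyp (by simp))

theorem and_mem_iff : and A B ∈ T ↔ A ∈ T ∧ B ∈ T := by
  refine ⟨fun h => ⟨hT.mem_of_mem h ?_, hT.mem_of_mem h ?_⟩, fun h => hT.mem_of_mem₂ h.1 h.2 ?_⟩
  · exact NSFp.wneg_wneg (.andE₁ (.hyp rfl))
  · exact NSFp.wneg_wneg (.andE₂ (.hyp rfl))
  · exact NSFp.wneg_wneg (.andI (.hyp (by simp)) (.hyp (by simp)))

theorem or_mem_iff : or A B ∈ T ↔ A ∈ T ∨ B ∈ T := by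
  constructor
  · intro h
    by_contra! hn
    refine hT.wneg_mem_iff.1 (hT.mem_of_mem₂ (hT.wneg_mem A hn.1) (hT.wneg_mem B hn.2)
      (NSFp.wneg_wneg (NSFp.wnegI ?_))) h
    exact .orE NSFp.head (NSFp.of_wneg (A := A) (.hyp (by simp)) NSFp.head)
      (NSFp.of_wneg (A := B) (.hyp (by simp)) NSFp.head)
  · rintro (h | h)
    · exact hT.mem_of_mem h (NSFp.wneg_wneg (.orI₁ (.hyp rfl)))
    · exact hT.mem_of_mem h (NSFp.wneg_wneg (.orI₂ (.hyp rfl)))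

theorem imp_mem_iff : imp A B ∈ T ↔ (A ∈ T → B ∈ T) := by
  constructor
  · exact fun h hA => hT.mem_of_mem₂ h hA (.impE (A := A) (.hyp (by simp)) (.hyp (by simp)))
  · intro h
    by_cases hA : A ∈ T
    · exact hT.mem_of_mem (h hA) (NSFp.wneg_wneg (.impI (NSFp.wneg_wneg (.hyp (by simp)))))
    · refine hT.mem_of_mem (hT.wneg_mem A hA) (NSFp.wneg_wneg (.impI (.botE ?_)))
      exact NSFp.of_wneg (A := A) (.hyp (by simp)) NSFp.head

theorem neg_mem_iff : neg A ∈ T ↔ A ∉ T := by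
  rw [← hT.wneg_mem_iff]
  constructor
  · intro h
    refine hT.mem_of_mem h (NSFp.wneg_wneg (NSFp.wnegI ?_))
    exact .negE (A := A) (.hyp (by simp)) NSFp.head
  · exact fun h => hT.mem_of_mem h (NSFp.wneg_wneg (.negI (.hyp rfl)))

theorem subst_mem_of_all {t : L.Term ℕ} (ht : A.FreeFor x t) (h : all x A ∈ T) :
    A.subst x t ∈ T :=
  hT.mem_of_mem h (.allE t ht (.hyp rfl))

/-- If `∀x A` is not in `T`, then `∃x ⇁A` is, and its witness `z ≥ N` contradicts the corresponding
instance. -/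
theorem all_mem (h : ∀ z ≥ N, A.subst x (Term.var z) ∈ T) : all x A ∈ T := by
  by_contra hn
  obtain ⟨z, hz, hm⟩ := hT.exists_witness x (wneg A)
    (hT.mem_of_mem (hT.wneg_mem _ hn) (NSFp.wneg_wneg_ex_of_wneg_all (.hyp rfl)))
  exact hT.wneg_mem_iff.1 hm (h z hz)

theorem ex_mem_of_subst {t : L.Term ℕ} (ht : A.FreeFor x t) (h : A.subst x t ∈ T) :
    ex x A ∈ T :=
  hT.mem_of_mem h (NSFp.wneg_wneg_ex ht (.hyp rfl))

theorem exi_mem (t : L.Term ℕ) : exi t ∈ T := hT.mem_of_nil (NSFp.wneg_wneg_exi t)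

end IsHenkin

end Calculus

end SFQ

namespace SFQ

open FirstOrder FirstOrder.Language

/-! ### The term model of a Henkin set, and completeness at the leaf. -/

section Completeness

variable {L : FirstOrder.Language.{0, 0}}

namespace Fm

/-- The number of the logical symbols and the atoms. -/
def size : Fm L → ℕ
  | top => 1
  | bot => 1
  | rel _ _ => 1
  | and A B => A.size + B.size + 1
  | or A B => A.size + B.size + 1
  | imp A B => A.size + B.size + 1
  | neg A => A.size + 1
  | all _ A => A.size + 1
  | ex _ A => A.size + 1

theorem size_subst (A : Fm L) (x : ℕ) (t : L.Term ℕ) : (A.subst x t).size = A.size := by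
  induction A with
  | all z A ih | ex z A ih => simp only [subst]; split_ifs <;> simp [size, ih]
  | _ => simp_all [subst, size]

theorem size_pos (A : Fm L) : 0 < A.size := by cases A <;> simp [size]

instance countable [Countable L.Symbols] : Countable (Fm L) := by
  have hf : Countable (Σ n, L.Functions n) :=
    Function.Injective.countable (f := (Sum.inl : _ → L.Symbols)) Sum.inl_injective
  have hr : Countable (Σ n, L.Relations n) :=
    Function.Injective.countable (f := (Sum.inr : _ → L.Symbols)) Sum.inr_injective
  have hs : ∀ n, {A : Fm L | A.size ≤ n}.Countable := by
    intro n
    induction n with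
    | zero =>
      convert Set.countable_empty (α := Fm L)
      ext A
      simpa using A.size_pos.ne'
    | succ n ih =>
      let S := {A : Fm L | A.size ≤ n}
      have hS : S.Countable := ih
      have hR : (Set.range fun p : Σ P : (Σ n, L.Relations n), Fin P.1 → L.Term ℕ =>
          rel p.1.2 p.2).Countable := Set.countable_range _
      have hu : (Set.univ : Set ℕ).Countable := Set.countable_univ
      refine (((((((((Set.countable_singleton top).union (Set.countable_singleton bot)).union
        hR).union (hS.image2 hS and)).union (hS.image2 hS or)).union (hS.image2 hS imp)).union
        (hS.image neg)).union (hu.image2 hS all)).union (hu.image2 hS ex)).mono ?_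
      intro A hA
      simp only [Set.mem_ofPred_eq] at hA
      cases A with
      | top | bot => simp
      | rel P ts =>
        have : rel P ts ∈ Set.range fun p : Σ P : (Σ n, L.Relations n), Fin P.1 → L.Term ℕ =>
          rel p.1.2 p.2 := ⟨⟨⟨_, P⟩, ts⟩, rfl⟩
        simp only [Set.mem_union]
        tauto
      | and A B =>
        have : and A B ∈ Set.image2 and S S :=
          Set.mem_image2_of_mem (by simp [S, size] at hA ⊢; omega) (by simp [S, size] at hA ⊢; omega)
        simp only [Set.mem_union]
        tauto
      | or A B =>
        have : or A B ∈ Set.image2 or S S :=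
          Set.mem_image2_of_mem (by simp [S, size] at hA ⊢; omega) (by simp [S, size] at hA ⊢; omega)
        simp only [Set.mem_union]
        tauto
      | imp A B =>
        have : imp A B ∈ Set.image2 imp S S :=
          Set.mem_image2_of_mem (by simp [S, size] at hA ⊢; omega) (by simp [S, size] at hA ⊢; omega)
        simp only [Set.mem_union]
        tauto
      | neg A =>
        have : neg A ∈ neg '' S := Set.mem_image_of_mem _ (by simp [S, size] at hA ⊢; omega)
        simp only [Set.mem_union]
        tauto
      | all x A =>
        have : all x A ∈ Set.image2 all Set.univ S :=
          Set.mem_image2_of_mem trivial (by simp [S, size] at hA ⊢; omega)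
        simp only [Set.mem_union]
        tauto
      | ex x A =>
        have : ex x A ∈ Set.image2 ex Set.univ S :=
          Set.mem_image2_of_mem trivial (by simp [S, size] at hA ⊢; omega)
        simp only [Set.mem_union]
        tauto
  have : (Set.univ : Set (Fm L)).Countable := by
    convert Set.countable_iUnion hs
    ext A
    simpa using ⟨A.size, le_rfl⟩
  exact Set.countable_univ_iff.1 this

/-- The predicate symbols of a formula. -/
def preds : Fm L → Set (Σ n, L.Relations n)
  | top => ∅
  | bot => ∅
  | rel P _ => {⟨_, P⟩}
  | and A B => A.preds ∪ B.preds
  | or A B => A.preds ∪ B.preds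
  | imp A B => A.preds ∪ B.preds
  | neg A => A.preds
  | all _ A => A.preds
  | ex _ A => A.preds

/-- Finite verification allows only finitely many nonempty predicates at a node, so the term model
interprets just those of the target formula, besides `E`. -/
theorem finite_preds (A : Fm L) : A.preds.Finite := by
  induction A <;> simp_all [preds]

theorem preds_subst (A : Fm L) (x : ℕ) (t : L.Term ℕ) : (A.subst x t).preds = A.preds := by
  induction A with
  | all z A ih | ex z A ih => simp only [subst]; split_ifs <;> simp [preds, ih]
  | _ => simp_all [subst, preds]

end Fm

/-- Terms all of whose variables are `≥ N`. -/
abbrev ParamTerm (L : FirstOrder.Language.{0, 0}) (N : ℕ) : Type :=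
  {t : L.Term ℕ // ∀ y ∈ t.varFinset, N ≤ y}

instance (N : ℕ) : Nonempty (ParamTerm L N) := ⟨⟨Term.var N, by simp [Term.varFinset]⟩⟩

variable [HasE L]

/-- The model with an empty root whose leaf is the term model of `T`, restricted to the predicate
symbols in `Q` and the existence predicate. -/
abbrev henkinCDModel (L : FirstOrder.Language.{0, 0}) [HasE L] (N : ℕ) (T : Set (Fm L))
    (Q : Set (Σ n, L.Relations n)) : CDModel L where
  K := Bool
  root := false
  root_le := Bool.false_le
  chain_below k := fun a _ b _ _ => le_total a b
  finite_below _ := Set.toFinite _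
  countable_branching _ := Set.to_countable _
  D := ParamTerm L N
  J f xs := ⟨Term.func f fun i => (xs i).1, fun y hy => by
    simp only [Term.varFinset, Finset.mem_biUnion, Finset.mem_univ, true_and] at hy
    obtain ⟨i, hi⟩ := hy
    exact (xs i).2 y hi⟩
  v k n P := {xs | k = true ∧ (⟨n, P⟩ : Σ n, L.Relations n) ∈ insert ⟨1, HasE.E⟩ Q ∧
    Fm.rel P (fun i => (xs i).1) ∈ T}
  v_mono := by
    rintro k k' h n P xs ⟨rfl, h'⟩
    exact ⟨top_le_iff.1 h, h'⟩

/-- The strict finitistic model of a Henkin set. -/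
abbrev henkinModel {N : ℕ} {T : Set (Fm L)} (hT : IsHenkin N T) {Q : Set (Σ n, L.Relations n)}
    (hQ : Q.Finite) : SFModel L where
  toCDModel := henkinCDModel L N T Q
  strictness := by
    -- An atom can hold only at the leaf, where `E` holds of every element.
    rintro k n P c s - ⟨rfl, -⟩ i c' -
    exact ⟨rfl, Set.mem_insert _ _, hT.exi_mem _⟩
  finite_verification k := by
    refine (hQ.insert ⟨1, HasE.E⟩).subset ?_
    rintro ⟨n, P⟩ ⟨xs, -, h, -⟩
    exact h

namespace IsHenkin

variable {N : ℕ} {T : Set (Fm L)} (hT : IsHenkin N T) {Q : Set (Σ n, L.Relations n)}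
  (hQ : Q.Finite)

theorem hasLeaf : (henkinModel hT hQ).HasLeaf true where
  eq_or_eq k := by
    cases k
    · exact .inl rfl
    · exact .inr rfl
  full _ := ⟨rfl, Set.mem_insert _ _, hT.exi_mem _⟩
  empty _ h := Bool.false_ne_true h.1

theorem notMem_v_root {n : ℕ} (P : L.Relations n) (xs) :
    xs ∉ (henkinModel hT hQ).v (henkinModel hT hQ).root P := fun h => Bool.false_ne_true h.1

theorem isTwoNode : (henkinModel hT hQ).IsTwoNode := by
  change Nat.card Bool = 2
  simp

theorem isPreconstructive : (henkinModel hT hQ).IsPreconstructive := by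
  intro c hc h
  have hcl : (Fm.exi c).Closed := by
    rw [TClosed] at hc
    simp [Fm.Closed, Fm.exi, Fm.fv, hc]
  have := (SFModel.forces_iff _ hcl fun _ => Classical.arbitrary _).1 h
  exact hT.notMem_v_root hQ HasE.E _ this

theorem isPrevalent : (henkinModel hT hQ).IsPrevalent := by
  refine ⟨fun A hA ⟨k, hk⟩ j => ⟨true, (hT.hasLeaf hQ).le_leaf j, fun s => ?_⟩, fun d j =>
    ⟨true, (hT.hasLeaf hQ).le_leaf j, ?_⟩⟩
  · exact SFModel.sat_mono _ ((hT.hasLeaf hQ).le_leaf k) (hk s)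
  · exact (SFModel.forces_exi_name _).2 ((hT.hasLeaf hQ).full d)

open scoped Classical in
/-- The assignment that maps the variables `≥ N` to themselves. -/
noncomputable def assignment (L : FirstOrder.Language.{0, 0}) (N : ℕ) (n : ℕ) : ParamTerm L N :=
  if h : N ≤ n then ⟨Term.var n, by simpa [Term.varFinset] using h⟩ else Classical.arbitrary _

theorem val_assignment (t : L.Term ℕ) (ht : ∀ y ∈ t.varFinset, N ≤ y) :
    (henkinModel hT hQ).val (assignment L N)
      ((L.lhomWithConstants (henkinModel hT hQ).D).onTerm t) = ⟨t, ht⟩ := by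
  induction t with
  | var n =>
    have h : N ≤ n := ht n (by simp [Term.varFinset])
    exact dif_pos h
  | func f ts ih =>
    have ih' := fun i => ih i fun y hy => ht y (by simpa [Term.varFinset] using ⟨i, hy⟩)
    change (henkinModel hT hQ).J f (fun i => (henkinModel hT hQ).val (assignment L N)
      ((L.lhomWithConstants (henkinModel hT hQ).D).onTerm (ts i))) = _
    simp only [ih']

/-- The truth lemma. -/
theorem sat_iff_mem (A : Fm L) (hb : ∀ y ∈ A.bv, y < N) (hf : ∀ y ∈ A.fv, N ≤ y)
    (hp : A.preds ⊆ Q) :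
    (henkinModel hT hQ).Sat true (assignment L N) (A.lift _) ↔ A ∈ T := by
  have H := hT.hasLeaf hQ
  -- Induction on size, because the quantifier cases appeal to substitution instances of the body.
  induction hn : A.size using Nat.strong_induction_on generalizing A with
  | _ n IH =>
  subst hn
  have inst : ∀ (x : ℕ) (B : Fm L) (d : ParamTerm L N), B.size < A.size → (∀ y ∈ B.bv, y < N) →
      (∀ y ∈ B.fv.erase x, N ≤ y) → B.preds ⊆ Q →
      ((henkinModel hT hQ).Sat true (Function.update (assignment L N) x d) (B.lift _) ↔
        B.subst x d.1 ∈ T) ∧ B.FreeFor x d.1 := by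
    intro x B d hs hb hf hp
    -- Bound variables lie below `N` and the variables of domain elements do not, so no capture
    -- occurs.
    have hff : B.FreeFor x d.1 :=
      Fm.freeFor_of_disjoint fun y hy hyd => (hb y hy).not_ge (d.2 y hyd)
    have h := IH B.size hs (B.subst x d.1) (by rwa [Fm.bv_subst]) (fun y hy => ?_)
      (by rwa [Fm.preds_subst]) (Fm.size_subst _ _ _)
    · rw [SFModel.sat_lift_subst hff, hT.val_assignment hQ d.1 d.2] at h
      exact ⟨h, hff⟩
    · rcases Finset.mem_union.1 (Fm.fv_subst_subset _ _ _ hy) with h | h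
      · exact hf y h
      · exact d.2 y h
  cases A with
  | top => exact iff_of_true trivial (hT.mem_of_nil (NSFp.wneg_wneg .topI))
  | bot => exact iff_of_false id hT.bot_notMem
  | rel P ts =>
    have hv : ∀ i, ((henkinModel hT hQ).val (assignment L N)
        ((L.lhomWithConstants (henkinModel hT hQ).D).onTerm (ts i))).1 = ts i := fun i => by
      rw [hT.val_assignment hQ (ts i) fun y hy => hf y (by simpa [Fm.fv] using ⟨i, hy⟩)]
    have : (henkinModel hT hQ).Sat true (assignment L N) ((Fm.rel P ts).lift _) ↔
        true = true ∧ (⟨_, P⟩ : Σ n, L.Relations n) ∈ insert ⟨1, HasE.E⟩ Q ∧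
        Fm.rel P (fun i => ((henkinModel hT hQ).val (assignment L N)
          ((L.lhomWithConstants (henkinModel hT hQ).D).onTerm (ts i))).1) ∈ T := Iff.rfl
    rw [this]
    simp only [hv]
    exact ⟨fun h => h.2.2, fun h => ⟨trivial, .inr (hp rfl), h⟩⟩
  | and B C =>
    simp only [Fm.bv, Fm.fv, Finset.mem_union, Fm.preds, Set.union_subset_iff] at hb hf hp
    have hB := IH B.size (by simp only [Fm.size]; omega) B (fun y hy => hb y (.inl hy))
      (fun y hy => hf y (.inl hy)) hp.1 rfl
    have hC := IH C.size (by simp only [Fm.size]; omega) C (fun y hy => hb y (.inr hy))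
      (fun y hy => hf y (.inr hy)) hp.2 rfl
    exact (and_congr hB hC).trans hT.and_mem_iff.symm
  | or B C =>
    simp only [Fm.bv, Fm.fv, Finset.mem_union, Fm.preds, Set.union_subset_iff] at hb hf hp
    have hB := IH B.size (by simp only [Fm.size]; omega) B (fun y hy => hb y (.inl hy))
      (fun y hy => hf y (.inl hy)) hp.1 rfl
    have hC := IH C.size (by simp only [Fm.size]; omega) C (fun y hy => hb y (.inr hy))
      (fun y hy => hf y (.inr hy)) hp.2 rfl
    exact (or_congr hB hC).trans hT.or_mem_iff.symm
  | imp B C =>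
    simp only [Fm.bv, Fm.fv, Finset.mem_union, Fm.preds, Set.union_subset_iff] at hb hf hp
    have hB := IH B.size (by simp only [Fm.size]; omega) B (fun y hy => hb y (.inl hy))
      (fun y hy => hf y (.inl hy)) hp.1 rfl
    have hC := IH C.size (by simp only [Fm.size]; omega) C (fun y hy => hb y (.inr hy))
      (fun y hy => hf y (.inr hy)) hp.2 rfl
    exact H.sat_imp.trans ((imp_congr hB hC).trans hT.imp_mem_iff.symm)
  | neg B =>
    exact H.sat_neg.trans
      ((not_congr (IH B.size (by simp [Fm.size]) B hb hf hp rfl)).trans hT.neg_mem_iff.symm)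
  | all x B =>
    simp only [Fm.bv, Finset.mem_insert] at hb
    have hB := fun d => inst x B d (by simp [Fm.size]) (fun y hy => hb y (.inr hy)) hf hp
    refine H.sat_all.trans ⟨fun h => hT.all_mem fun z hz => ?_, fun h d => ?_⟩
    · let d : ParamTerm L N := ⟨Term.var z, by simpa [Term.varFinset] using hz⟩
      exact (hB d).1.1 (h d)
    · exact (hB d).1.2 (hT.subst_mem_of_all (hB d).2 h)
  | ex x B =>
    simp only [Fm.bv, Finset.mem_insert] at hb
    have hB := fun d => inst x B d (by simp [Fm.size]) (fun y hy => hb y (.inr hy)) hf hp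
    refine H.sat_ex_leaf.trans ⟨fun ⟨d, h⟩ => ?_, fun h => ?_⟩
    · exact hT.ex_mem_of_subst (hB d).2 ((hB d).1.1 h)
    · obtain ⟨z, hz, h⟩ := hT.exists_witness x B h
      let d : ParamTerm L N := ⟨Term.var z, by simpa [Term.varFinset] using hz⟩
      exact ⟨d, (hB d).1.2 h⟩

end IsHenkin

/-- Completeness for truth at the leaves of the two-node models with an empty root. -/
theorem wneg_wneg_of_valid [Countable L.Symbols] {A : Fm L} (hc : A.Closed)
    (h : ∀ (W : SFModel L) (l : W.K), W.IsPrevalent → W.IsTwoNode → W.IsPreconstructive →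
      W.HasLeaf l → (∀ {n : ℕ} (P : L.Relations n) (xs), xs ∉ W.v W.root P) →
      ∃ s, W.Sat l s (A.lift W.D)) :
    NSFp ∅ (.wneg (.wneg A)) := by
  by_contra hn
  -- `N` separates the bound variables of `A` from the variables that serve as witnesses and
  -- generate the domain.
  obtain ⟨N, hN⟩ : ∃ N, ∀ y ∈ A.bv, y < N :=
    ⟨A.bv.sup id + 1, fun y hy => Nat.lt_succ_of_le (Finset.le_sup (f := id) hy)⟩
  obtain ⟨T, hsub, hT⟩ := exists_isHenkin N (Γ := {Fm.wneg A}) (Set.finite_singleton _)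
    (fun h' => hn (NSFp.wnegI (by simpa using h')))
  have hQ := A.finite_preds
  obtain ⟨s, hs⟩ := h (henkinModel hT hQ) true (hT.isPrevalent hQ) (hT.isTwoNode hQ)
    (hT.isPreconstructive hQ) (hT.hasLeaf hQ) (fun P xs => hT.notMem_v_root hQ P xs)
  rw [SFModel.sat_congr_of_closed (s' := IsHenkin.assignment L N) _ (by simpa [Fm.Closed] using hc),
    hT.sat_iff_mem hQ A hN (by rw [Fm.Closed] at hc; simp [hc]) subset_rfl] at hs
  exact hT.wneg_mem_iff.1 (hsub rfl) hs

end Completeness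

end SFQ

namespace SFQ

open FirstOrder FirstOrder.Language

/-! ### Normal forms in `ST_P`, and completeness at the root. -/

section NormalForm

variable {L : FirstOrder.Language.{0, 0}} [HasE L]

/-- `S` is a formula of the class `ST_P` that implies `T` and all members of `l`, and that holds at
the leaf whenever these hold at a root without true atoms. -/
structure IsNormalForm (l : List (Fm L)) (T S : Fm L) : Prop where
  stp : S.STP
  derivable : ∀ A ∈ T :: l, NSFp {S} A
  locOcc : ∀ x, S.LocOcc x → ∃ A ∈ T :: l, A.LocOcc x
  fv : ∀ x ∈ S.fv, ∃ A ∈ T :: l, x ∈ A.fv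
  sat : ∀ (W : SFModel L) (k : W.K), W.HasLeaf k →
    (∀ {n : ℕ} (P : L.Relations n) (xs), xs ∉ W.v W.root P) → ∀ s,
    (∀ A ∈ T :: l, W.Sat W.root s (A.lift W.D)) → W.Sat k s (S.lift W.D)

namespace IsNormalForm

variable {l : List (Fm L)} {T S S' A B : Fm L} {x z : ℕ}

/-- For formulas that fail at every root without true atoms: `⊥`, atoms (nullary ones included) and
local existential formulas. -/
theorem bot (h : ∀ (W : SFModel L) (k : W.K), W.HasLeaf k →
    (∀ {n : ℕ} (P : L.Relations n) (xs), xs ∉ W.v W.root P) → ∀ s,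
    ¬ W.Sat W.root s (A.lift W.D)) : IsNormalForm (A :: l) T .bot where
  stp := .st (.gn .bot)
  derivable _ _ := .botE (.hyp rfl)
  locOcc _ h := h.elim
  fv _ h := by simp [Fm.fv] at h
  sat W k H he s hs := (h W k H he s (hs A (by simp))).elim

theorem top (h : IsNormalForm l T S) : IsNormalForm (.top :: l) T S where
  stp := h.stp
  derivable A hA := by
    simp only [List.mem_cons] at hA
    rcases hA with rfl | rfl | hA
    · exact h.derivable _ (by simp)
    · exact .topI
    · exact h.derivable _ (by simp [hA])
  locOcc x hx := by
    obtain ⟨A, hA, h'⟩ := h.locOcc x hx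
    exact ⟨A, by simp at hA ⊢; tauto, h'⟩
  fv x hx := by
    obtain ⟨A, hA, h'⟩ := h.fv x hx
    exact ⟨A, by simp at hA ⊢; tauto, h'⟩
  sat W k H he s hs := h.sat W k H he s fun A hA => hs A (by simp at hA ⊢; tauto)

/-- A stable formula needs no further decomposition and joins the accumulated conjunction `T`. -/
theorem st (h : IsNormalForm l (.and T A) S) : IsNormalForm (A :: l) T S where
  stp := h.stp
  derivable B hB := by
    simp only [List.mem_cons] at hB
    rcases hB with rfl | rfl | hB
    · exact .andE₁ (h.derivable (.and _ A) (by simp))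
    · exact .andE₂ (h.derivable (.and T _) (by simp))
    · exact h.derivable _ (by simp [hB])
  locOcc x hx := by
    obtain ⟨B, hB, h'⟩ := h.locOcc x hx
    rcases List.mem_cons.1 hB with rfl | hB
    · rcases h'.2 with h' | h'
      · exact ⟨T, by simp, h'⟩
      · exact ⟨A, by simp, h'⟩
    · exact ⟨B, by simp [hB], h'⟩
  fv x hx := by
    obtain ⟨B, hB, h'⟩ := h.fv x hx
    rcases List.mem_cons.1 hB with rfl | hB
    · rcases Finset.mem_union.1 h' with h' | h'
      · exact ⟨T, by simp, h'⟩
      · exact ⟨A, by simp, h'⟩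
    · exact ⟨B, by simp [hB], h'⟩
  sat W k H he s hs := h.sat W k H he s fun B hB => by
    rcases List.mem_cons.1 hB with rfl | hB
    · exact ⟨hs T (by simp), hs A (by simp)⟩
    · exact hs B (by simp [hB])

theorem and (h : IsNormalForm (A :: B :: l) T S) : IsNormalForm (.and A B :: l) T S where
  stp := h.stp
  derivable C hC := by
    simp only [List.mem_cons] at hC
    rcases hC with rfl | rfl | hC
    · exact h.derivable _ (by simp)
    · exact .andI (h.derivable A (by simp)) (h.derivable B (by simp))
    · exact h.derivable _ (by simp [hC])
  locOcc x hx := by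
    obtain ⟨C, hC, h'⟩ := h.locOcc x hx
    by_cases hg : Fm.GN (.and A B)
    · have hn := Fm.gn_and.1 hg
      simp only [List.mem_cons] at hC
      rcases hC with rfl | rfl | rfl | hC
      · exact ⟨C, by simp, h'⟩
      · exact (hn.1.not_locOcc x h').elim
      · exact (hn.2.not_locOcc x h').elim
      · exact ⟨C, by simp [hC], h'⟩
    · simp only [List.mem_cons] at hC
      rcases hC with rfl | rfl | rfl | hC
      · exact ⟨C, by simp, h'⟩
      · exact ⟨.and C B, by simp, hg, .inl h'⟩
      · exact ⟨.and A C, by simp, hg, .inr h'⟩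
      · exact ⟨C, by simp [hC], h'⟩
  fv x hx := by
    obtain ⟨C, hC, h'⟩ := h.fv x hx
    simp only [List.mem_cons] at hC
    rcases hC with rfl | rfl | rfl | hC
    · exact ⟨C, by simp, h'⟩
    · exact ⟨.and C B, by simp, by simp [Fm.fv, h']⟩
    · exact ⟨.and A C, by simp, by simp [Fm.fv, h']⟩
    · exact ⟨C, by simp [hC], h'⟩
  sat W k H he s hs := h.sat W k H he s fun C hC => by
    have hAB := hs (.and A B) (by simp)
    simp only [List.mem_cons] at hC
    rcases hC with rfl | rfl | rfl | hC
    · exact hs C (by simp)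
    · exact hAB.1
    · exact hAB.2
    · exact hs C (by simp [hC])

/-- `ST` is not closed under arbitrary disjunctions, so `∨` is moved outwards, where `ST_P` admits
it; `T` and `l` are duplicated in both branches. -/
theorem or (h : IsNormalForm (A :: l) T S) (hB : IsNormalForm (B :: l) T S') :
    IsNormalForm (.or A B :: l) T (.or S S') where
  stp := .or h.stp hB.stp
  derivable C hC := by
    simp only [List.mem_cons] at hC
    refine .orE (.hyp rfl) (.weaken (Γ := {S}) (by simp) ?_) (.weaken (Γ := {S'}) (by simp) ?_)
    · rcases hC with rfl | rfl | hC
      · exact h.derivable _ (by simp)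
      · exact .orI₁ (h.derivable _ (by simp))
      · exact h.derivable _ (by simp [hC])
    · rcases hC with rfl | rfl | hC
      · exact hB.derivable _ (by simp)
      · exact .orI₂ (hB.derivable _ (by simp))
      · exact hB.derivable _ (by simp [hC])
  locOcc x hx := by
    rcases hx.2 with hx | hx
    · obtain ⟨C, hC, h'⟩ := h.locOcc x hx
      simp only [List.mem_cons] at hC
      rcases hC with rfl | rfl | hC
      · exact ⟨C, by simp, h'⟩
      · exact ⟨.or C B, by simp, fun hg => (Fm.gn_or.1 hg).1.not_locOcc x h', .inl h'⟩
      · exact ⟨C, by simp [hC], h'⟩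
    · obtain ⟨C, hC, h'⟩ := hB.locOcc x hx
      simp only [List.mem_cons] at hC
      rcases hC with rfl | rfl | hC
      · exact ⟨C, by simp, h'⟩
      · exact ⟨.or A C, by simp, fun hg => (Fm.gn_or.1 hg).2.not_locOcc x h', .inr h'⟩
      · exact ⟨C, by simp [hC], h'⟩
  fv x hx := by
    rcases Finset.mem_union.1 hx with hx | hx
    · obtain ⟨C, hC, h'⟩ := h.fv x hx
      simp only [List.mem_cons] at hC
      rcases hC with rfl | rfl | hC
      · exact ⟨C, by simp, h'⟩
      · exact ⟨.or C B, by simp, by simp [Fm.fv, h']⟩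
      · exact ⟨C, by simp [hC], h'⟩
    · obtain ⟨C, hC, h'⟩ := hB.fv x hx
      simp only [List.mem_cons] at hC
      rcases hC with rfl | rfl | hC
      · exact ⟨C, by simp, h'⟩
      · exact ⟨.or A C, by simp, by simp [Fm.fv, h']⟩
      · exact ⟨C, by simp [hC], h'⟩
  sat W k H he s hs := by
    have : ∀ D : Fm L, W.Sat W.root s (D.lift W.D) →
        ∀ C ∈ T :: D :: l, W.Sat W.root s (C.lift W.D) := fun D hD C hC => by
      simp only [List.mem_cons] at hC
      rcases hC with rfl | rfl | hC
      · exact hs C (by simp)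
      · exact hD
      · exact hs C (by simp [hC])
    exact (hs (.or A B) (by simp)).imp (fun hA => h.sat W k H he s (this A hA))
      (fun h' => hB.sat W k H he s (this B h'))

/-- A global `∃` is moved outwards under a fresh name `z`. The result must again be global: `z` has
no local occurrence in `S` because `x` has none in `A`, which is what the field `locOcc` tracks. If
`z` has vanished from `S`, then `∃z S` would be vacuous and hence local, so `S` itself is kept. -/
theorem ex (hg : Fm.OnlyGlobal x A) (hb : z ∉ A.bv) (hA : z ∉ A.fv) (hl : ∀ C ∈ T :: l, z ∉ C.fv)
    (h : IsNormalForm (A.subst x (Term.var z) :: l) T S) :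
    IsNormalForm (.ex x A :: l) T (if z ∈ S.fv then .ex z S else S) := by
  have hff : A.FreeFor x (Term.var z) := Fm.freeFor_of_disjoint fun y hy hyz => by
    simp only [Term.varFinset, Finset.mem_singleton] at hyz
    exact hb (hyz ▸ hy)
  have hzx : z ∉ (Fm.ex x A).fv := by simp [Fm.fv, hA]
  have hz : ∀ C ∈ T :: .ex x A :: l, z ∉ C.fv := fun C hC => by
    simp only [List.mem_cons] at hC
    rcases hC with rfl | rfl | hC
    · exact hl C (by simp)
    · exact hzx
    · exact hl C (by simp [hC])
  have der : ∀ C ∈ T :: .ex x A :: l, NSFp {S} C := fun C hC => by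
    simp only [List.mem_cons] at hC
    rcases hC with rfl | rfl | hC
    · exact h.derivable _ (by simp)
    · exact .exGloI _ hff hg (h.derivable _ (by simp))
    · exact h.derivable _ (by simp [hC])
  have loc : ∀ y, S.LocOcc y → y ≠ z ∧ ∃ C ∈ T :: .ex x A :: l, C.LocOcc y := fun y hy => by
    obtain ⟨C, hC, h'⟩ := h.locOcc y hy
    simp only [List.mem_cons] at hC
    have out : C ∈ T :: l → y ≠ z ∧ ∃ C ∈ T :: .ex x A :: l, C.LocOcc y := fun hC =>
      ⟨fun e => hl C hC (e ▸ h'.mem_fv), C, by simp at hC ⊢; tauto, h'⟩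
    rcases hC with rfl | rfl | hC
    · exact out (by simp)
    · have hyz : y ≠ z := by
        rintro rfl
        exact hg.2 (Fm.LocOcc.of_subst_var hA hb h')
      have hyv : y ∉ (Term.var z : L.Term ℕ).varFinset := by simpa [Term.varFinset] using hyz
      have hyx : y ≠ x := by
        rintro rfl
        have := Fm.fv_subst_subset _ _ _ h'.mem_fv
        exact hyv (by simpa using this)
      have hy' := (Fm.locOcc_subst hff hyx hyv).1 h'
      exact ⟨hyz, .ex x A, by simp, fun hn => (Fm.gn_ex.1 hn).2.not_locOcc y hy', hyx.symm, hy'⟩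
    · exact out (by simp [hC])
  have free : ∀ y ∈ S.fv, y ≠ z → ∃ C ∈ T :: .ex x A :: l, y ∈ C.fv := fun y hy hyz => by
    obtain ⟨C, hC, h'⟩ := h.fv y hy
    simp only [List.mem_cons] at hC
    rcases hC with rfl | rfl | hC
    · exact ⟨C, by simp, h'⟩
    · refine ⟨.ex x A, by simp, ?_⟩
      have := Fm.fv_subst_subset _ _ _ h'
      simp only [Term.varFinset, Finset.mem_union, Finset.mem_singleton, hyz, or_false] at this
      exact this
    · exact ⟨C, by simp [hC], h'⟩
  have sat : ∀ (W : SFModel L) (k : W.K), W.HasLeaf k →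
      (∀ {n : ℕ} (P : L.Relations n) (xs), xs ∉ W.v W.root P) → ∀ s,
      (∀ C ∈ T :: .ex x A :: l, W.Sat W.root s (C.lift W.D)) →
      ∃ d, W.Sat k (Function.update s z d) (S.lift W.D) := fun W k H he s hs => by
    obtain ⟨-, d, hd⟩ := H.sat_ex_root.1 (hs (.ex x A) (by simp))
    refine ⟨d, h.sat W k H he _ fun C hC => ?_⟩
    have out : C ∈ T :: l → W.Sat W.root (Function.update s z d) (C.lift W.D) := fun hC => by
      rw [W.sat_update_of_notMem (by simpa using hl C hC)]
      exact hs C (by simp at hC ⊢; tauto)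
    simp only [List.mem_cons] at hC
    rcases hC with rfl | rfl | hC
    · exact out (by simp)
    · exact (SFModel.sat_lift_subst_var hff hzx).2 hd
    · exact out (by simp [hC])
  split_ifs with hzS
  · refine ⟨.ex z ⟨hzS, fun hn => (loc z hn).1 rfl⟩ h.stp, fun C hC => ?_, fun y hy => ?_,
      fun y hy => ?_, fun W k H he s hs => H.sat_ex_leaf.2 (sat W k H he s hs)⟩
    · refine NSFp.exE (Fm.freeFor_var_self S z) (by simp [Fm.fv]) (hz C hC)
        (by simp [Fm.fv]) (.hyp rfl) ?_
      rw [Fm.subst_var_self]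
      exact .weaken (by simp) (der C hC)
    · exact (loc y hy.2.2).2
    · exact free y (Finset.mem_of_mem_erase hy) (Finset.ne_of_mem_erase hy)
  · refine ⟨h.stp, der, fun y hy => (loc y hy).2, fun y hy => free y hy fun e => hzS (e ▸ hy),
      fun W k H he s hs => ?_⟩
    obtain ⟨d, hd⟩ := sat W k H he s hs
    rwa [W.sat_update_of_notMem (by simpa using hzS)] at hd

end IsNormalForm

/-- `T` collects the stable conjuncts and `l` holds the formulas still to be taken apart; the
induction is on the total size of `l`. Moving `∨` and global `∃` outwards leaves `T` as the
innermost matrix. -/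
theorem exists_isNormalForm (l : List (Fm L)) {T : Fm L} (hT : T.ST) :
    ∃ S, IsNormalForm l T S := by
  classical
  induction hn : (l.map Fm.size).sum using Nat.strong_induction_on generalizing l T with
  | _ n IH =>
  subst hn
  rcases l with _ | ⟨A, l⟩
  · refine ⟨T, .st hT, ?_, fun x hx => ⟨T, by simp, hx⟩, fun x hx => ⟨T, by simp, hx⟩,
      fun W k H _ s hs => W.sat_mono (H.le_leaf _) (hs T (by simp))⟩
    intro A hA
    rw [List.mem_singleton.1 hA]
    exact .hyp rfl
  have stable : A.ST → ∃ S, IsNormalForm (A :: l) T S := fun hA => by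
    obtain ⟨S, h⟩ := IH _ (by simp [A.size_pos]) l (hT.and hA) rfl
    exact ⟨S, h.st⟩
  cases A with
  | top =>
    obtain ⟨S, h⟩ := IH _ (by simp [Fm.size]) l hT rfl
    exact ⟨S, h.top⟩
  | bot => exact ⟨.bot, .bot fun _ _ _ _ _ => id⟩
  | rel P ts => exact ⟨.bot, .bot fun W k H he s h => he P _ h⟩
  | and A B =>
    obtain ⟨S, h⟩ := IH _ (by simp [Fm.size]; omega) (A :: B :: l) hT rfl
    exact ⟨S, h.and⟩
  | or A B =>
    obtain ⟨S, h⟩ := IH _ (by simp [Fm.size]) (A :: l) hT rfl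
    obtain ⟨S', h'⟩ := IH _ (by simp [Fm.size]) (B :: l) hT rfl
    exact ⟨_, h.or h'⟩
  | imp A B => exact stable (.imp A B)
  | neg A => exact stable (.gn (.neg A))
  | all x A => exact stable (.all x A)
  | ex x A =>
    by_cases hg : Fm.OnlyGlobal x A
    · obtain ⟨z, hz⟩ := Infinite.exists_notMem_finset
        (A.bv ∪ A.fv ∪ (T :: l).toFinset.biUnion Fm.fv)
      simp only [Finset.mem_union, not_or, Finset.mem_biUnion, List.mem_toFinset, not_exists,
        not_and] at hz
      obtain ⟨S, h⟩ := IH _ (by simp [Fm.size, Fm.size_subst]) (A.subst x (Term.var z) :: l) hT rfl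
      exact ⟨_, h.ex hg hz.1.1 hz.1.2 hz.2⟩
    · refine ⟨.bot, .bot fun W k H he s h => hg ?_⟩
      exact (Fm.onlyGlobal_map _).1 (H.sat_ex_root.1 h).1

/-- Completeness with respect to the preconstructive prevalent models with two nodes. -/
theorem derivable_of_valid [Countable L.Symbols] {A : Fm L} (hc : A.Closed)
    (h : ∀ (W : SFModel L) (l : W.K), W.IsPrevalent → W.IsTwoNode → W.IsPreconstructive →
      W.HasLeaf l → ∀ s, W.Sat W.root s (A.lift W.D)) : NSFp ∅ A := by
  obtain ⟨S, hS⟩ := exists_isNormalForm [A] Fm.ST.top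
  have hSc : S.Closed := by
    refine Finset.eq_empty_of_forall_notMem fun x hx => ?_
    obtain ⟨B, hB, hxB⟩ := hS.fv x hx
    simp only [List.mem_cons, List.not_mem_nil, or_false] at hB
    rcases hB with rfl | rfl
    · simp [Fm.fv] at hxB
    · rw [Fm.Closed] at hc; simp [hc] at hxB
  have hd : NSFp ∅ S := by
    -- Validity of `A` at the roots passes to `S` at the leaves of models with empty root; then
    -- `⇁⇁S` is derivable, and `S` is stable.
    refine .stp hS.stp (wneg_wneg_of_valid hSc fun W l h₁ h₂ h₃ H he => ?_)
    refine ⟨fun _ => Classical.arbitrary _, hS.sat W l H he _ fun B hB => ?_⟩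
    simp only [List.mem_cons, List.not_mem_nil, or_false] at hB
    rcases hB with rfl | rfl
    · trivial
    · exact h W l h₁ h₂ h₃ H _
  exact hd.cut (.weaken (by simp) (hS.derivable A (by simp)))

end NormalForm

/-! ### Counting occurrences of `→ ⊥`, and the two parts of the proposition. -/

section Main

variable {L : FirstOrder.Language.{0, 0}}

namespace Fm

/-- The number of the occurrences of the combination `→ ⊥`. -/
def wnegCount : Fm L → ℕ
  | top => 0
  | bot => 0
  | rel _ _ => 0
  | and A B => A.wnegCount + B.wnegCount
  | or A B => A.wnegCount + B.wnegCount
  | imp A bot => A.wnegCount + 1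
  | imp A B => A.wnegCount + B.wnegCount
  | neg A => A.wnegCount
  | all _ A => A.wnegCount
  | ex _ A => A.wnegCount

theorem wnegCount_imp {A B : Fm L} (h : B ≠ bot) :
    (imp A B).wnegCount = A.wnegCount + B.wnegCount := by
  cases B <;> first | rfl | exact (h rfl).elim

theorem exists_fill_wneg {A : Fm L} (h : ¬ A.WnegFree) :
    ∃ (F : Cont L) (B : Fm L), A = F.fill (wneg B) := by
  induction A with
  | top | bot | rel => exact (h trivial).elim
  | and A B ihA ihB =>
    rcases not_and_or.1 h with h | h
    · obtain ⟨F, C, rfl⟩ := ihA h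
      exact ⟨.andL F B, C, rfl⟩
    · obtain ⟨F, C, rfl⟩ := ihB h
      exact ⟨.andR A F, C, rfl⟩
  | or A B ihA ihB =>
    rcases not_and_or.1 h with h | h
    · obtain ⟨F, C, rfl⟩ := ihA h
      exact ⟨.orL F B, C, rfl⟩
    · obtain ⟨F, C, rfl⟩ := ihB h
      exact ⟨.orR A F, C, rfl⟩
  | imp A B ihA ihB =>
    by_cases hB : B = bot
    · exact ⟨.hole, A, by rw [hB]; rfl⟩
    rcases not_and_or.1 fun h' => h ⟨hB, h'⟩ with h | h
    · obtain ⟨F, C, rfl⟩ := ihA h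
      exact ⟨.impL F B, C, rfl⟩
    · obtain ⟨F, C, rfl⟩ := ihB h
      exact ⟨.impR A F, C, rfl⟩
  | neg A ih =>
    obtain ⟨F, C, rfl⟩ := ih h
    exact ⟨.neg F, C, rfl⟩
  | all x A ih =>
    obtain ⟨F, C, rfl⟩ := ih h
    exact ⟨.all x F, C, rfl⟩
  | ex x A ih =>
    obtain ⟨F, C, rfl⟩ := ih h
    exact ⟨.ex x F, C, rfl⟩

end Fm

theorem Cont.fill_ne_bot {F : Cont L} {B : Fm L} (h : B ≠ .bot) : F.fill B ≠ .bot := by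
  cases F <;> simp [fill, h]

/-- Neither `¬B` nor `⇁B` is `⊥`, so the exchange changes no other combination `→ ⊥`: the right side
of an implication containing the placeholder is never `⊥`. -/
theorem Cont.wnegCount_fill_wneg (F : Cont L) (B : Fm L) :
    (F.fill (.wneg B)).wnegCount = (F.fill (.neg B)).wnegCount + 1 := by
  induction F with
  | hole => rfl
  | impL F A ih =>
    by_cases hA : A = .bot
    · subst hA; simp only [fill, Fm.wnegCount, ih]
    · simp only [fill, Fm.wnegCount_imp hA, ih]; omega
  | impR A F ih =>
    simp only [fill]
    rw [Fm.wnegCount_imp (fill_ne_bot (by simp [Fm.wneg])),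
      Fm.wnegCount_imp (fill_ne_bot (by simp)), ih]
    omega
  | _ => simp_all only [fill, Fm.wnegCount]; try omega

variable [HasE L]

theorem mem_MM_of_derivable {F : Cont L} {B : Fm L} (hc : (F.fill (.wneg B)).Closed)
    (h : NSFp ∅ (F.fill (.wneg B))) : (F, B) ∈ MM L := by
  intro W h₁ h₂ h₃
  obtain ⟨l, H⟩ := W.exists_hasLeaf h₁ h₂ h₃
  have hs := H.sound h W.root (fun _ => Classical.arbitrary _) (by simp)
  rw [Fm.lift, Cont.fill_map] at hs
  refine H.mk_of_sat ?_ hs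
  have : (F.fill (.wneg B)).map (L.lhomWithConstants W.D) =
    (F.map (L.lhomWithConstants W.D)).fill (.wneg (B.map (L.lhomWithConstants W.D))) :=
    Cont.fill_map _ F _
  rw [← this]
  simpa [Fm.Closed] using hc

theorem fill_neg_mem_theorems [Countable L.Symbols] {F : Cont L} {B : Fm L}
    (h : F.fill (.wneg B) ∈ Theorems L) : F.fill (.neg B) ∈ Theorems L := by
  have hc := Cont.closed_fill_wneg.1 h.1
  refine ⟨hc, derivable_of_valid hc fun W l _ _ _ H s => ?_⟩
  have hs := H.sound h.2 W.root s (by simp)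
  rw [Fm.lift, Cont.fill_map] at hs ⊢
  exact H.sat_root_fill_neg hs

theorem fill_wneg_mem_theorems [Countable L.Symbols] {F : Cont L} {B : Fm L}
    (hm : (F, B) ∈ MM L) (h : F.fill (.neg B) ∈ Theorems L) :
    F.fill (.wneg B) ∈ Theorems L := by
  have hc := Cont.closed_fill_wneg.2 h.1
  refine ⟨hc, derivable_of_valid hc fun W l h₁ h₂ h₃ H s => ?_⟩
  have hs := H.sound h.2 W.root s (by simp)
  have hc' : ((F.fill (.neg B)).map (L.lhomWithConstants W.D)).Closed := by
    simpa [Fm.Closed] using h.1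
  rw [Fm.lift, Cont.fill_map] at hs ⊢
  rw [Cont.fill_map] at hc'
  exact H.sat_root_fill_wneg (hm W h₁ h₂ h₃) hc' hs

theorem iterate_PhiImage_subset [Countable L.Symbols] (n : ℕ) :
    (PhiImage L)^[n] (WnegFreeTheorems L) ⊆ Theorems L := by
  induction n with
  | zero => exact fun A hA => hA.1
  | succ n ih =>
    rw [Function.iterate_succ_apply']
    intro A hA
    simp only [PhiImage, Set.mem_iUnion] at hA
    obtain ⟨C, hC, F, B, hm, rfl, rfl⟩ := hA
    exact fill_wneg_mem_theorems hm (ih hC)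

/-- Any occurrence of `⇁` in a theorem may be turned into `¬`, giving a theorem with a smaller
count; part (i) supplies the membership in `𝓜` that lets `Φ` undo the step. -/
theorem mem_iterate_PhiImage [Countable L.Symbols] {A : Fm L} (hA : A ∈ Theorems L) :
    ∃ n, A ∈ (PhiImage L)^[n] (WnegFreeTheorems L) := by
  induction hn : A.wnegCount using Nat.strong_induction_on generalizing A with
  | _ m IH =>
  subst hn
  by_cases hf : A.WnegFree
  · exact ⟨0, hA, hf⟩
  · obtain ⟨F, B, rfl⟩ := Fm.exists_fill_wneg hf
    obtain ⟨n, h⟩ := IH _ (by rw [Cont.wnegCount_fill_wneg]; exact Nat.lt_succ_self _)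
      (fill_neg_mem_theorems hA) rfl
    refine ⟨n + 1, ?_⟩
    rw [Function.iterate_succ_apply']
    simp only [PhiImage, Set.mem_iUnion]
    exact ⟨_, h, F, B, mem_MM_of_derivable hA.1 hA.2, rfl, rfl⟩

end Main

end SFQ

theorem mainTheorem10 (L : FirstOrder.Language.{0, 0}) [Countable L.Symbols] [SFQ.HasE L] :
    (∀ (F : SFQ.Cont L) (B : SFQ.Fm L), (F.fill (SFQ.Fm.wneg B)).Closed →
      SFQ.NSFp ∅ (F.fill (SFQ.Fm.wneg B)) → (F, B) ∈ SFQ.MM L) ∧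
    SFQ.Theorems L = ⋃ n : ℕ, (SFQ.PhiImage L)^[n] (SFQ.WnegFreeTheorems L) := by
  refine ⟨fun F B hc h => SFQ.mem_MM_of_derivable hc h, Set.Subset.antisymm (fun A hA => ?_)
    (Set.iUnion_subset SFQ.iterate_PhiImage_subset)⟩
  exact Set.mem_iUnion.2 (SFQ.mem_iterate_PhiImage hA)
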